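/- Let $a,b,c,d,q\in\mathbb C$ with $0<|q|<1$, $a\neq 0$ and $ab\,q^k,\ ac\,q^k,\ ad\,q^k\neq 1$ for all $k\ge 0$. Write $(\sigma;q)_k=\prod_{i=0}^{k-1}(1-\sigma q^i)$, $(\sigma;q)_\infty=\lim_{k\to\infty}(\sigma;q)_k$, $(\sigma_1,\dots,\sigma_r;q)_k=\prod_j(\sigma_j;q)_k$ (also for $k=\infty$), $(E_q^{\pm1}f)(z)=f(q^{\pm1}z)$ and $\chi(z)=\frac{z+z^{-1}}2$. The Askey–Wilson polynomials are $$P_n(\chi(z))=\frac{(ab,ac,ad;q)_n}{a^n}\;{}_4\phi_3\!\left({q^{-n},\,abcdq^{n-1},\,az,\,az^{-1}\atop ab,\,ac,\,ad}\,\Big|\,q;q\right),$$ and the Askey–Wilson operator is $$\mathcal L=v(z)E_q-(v(z)+v(z^{-1}))+v(z^{-1})E_q^{-1},\qquad v(z)=\frac{(1-az)(1-bz)(1-cz)(1-dz)}{(1-z^2)(1-qz^2)} .$$ For $t\ne0$ and $n\in\mathbb Z$ put ${}^t\lambda(n)=-(1-tq^{-n})(1-abcd\,t^{-1}q^{n-1})$.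 Let $A_{-1}=-(a+b+c+d)$, $A_0=ab+ac+ad+bc+bd+cd$, $A_1=-(abc+abd+bcd+acd)$, $A_2=abcd$, $$\mathcal A(z)=\frac{z^{-2}+A_{-1}z^{-1}+A_0+A_1z+A_2z^2}{qz-z^{-1}},\qquad {}^t\mathcal F(z;n)=\frac{F_{-2}z^{-2}+F_{-1}z^{-1}+F_0+F_1z+F_2z^2}{qz-z^{-1}},$$ where, with $\lambda={}^t\lambda(n)$ and $\lambda'={}^t\lambda(n+1)$, $$F_{-2}=\frac{\lambda-q\lambda'}{q^2-1}-\frac{q+A_2}{q^2+q},\qquad F_2=\frac{q\lambda-\lambda'}{1-q^2}q^2-\frac{q^2+qA_2}{q+1},$$ $$F_{-1}=\frac{\beta_0}2-\frac{A_1+qA_{-1}}{2q},\qquad F_1=-\frac{q\beta_0}2-\frac{A_1+qA_{-1}}2,$$ $$F_0=\frac{q^2-q^3-A_0(q+q^2)+A_2(q-1)+q^2(\lambda+\lambda')}{q+q^2},$$ $$\beta_0=\frac{1-q}{(\lambda-\lambda')q^3}\Big\{\Big(2\frac{q\lambda-\lambda'}{1-q^2}q^2+\frac{\lambda'-\lambda}{1-q}q^2-2\frac{q^2+qA_2}{1+q}\Big)(A_1+qA_{-1})+2A_1q^2+2A_2A_{-1}q\Big\}.$$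 Let $$u(z,t,\alpha)=\frac{(az,az^{-1};q)_\infty}{(a\alpha z,a\alpha z^{-1};q)_\infty}\sum_{i=0}^\infty\frac{(\alpha t,\,abcd\,\alpha t^{-1}q^{-1},\,a\alpha z,\,a\alpha z^{-1};q)_i}{(ab\alpha,\,ac\alpha,\,ad\alpha,\,\alpha q;q)_i}\,q^i,$$ $$y(z,t)=u(z,t,1)-\alpha\,\frac{(t,\,abcd\,t^{-1}q^{-1},\,ab\alpha,\,ac\alpha,\,ad\alpha,\,\alpha q;q)_\infty}{(ab,\,ac,\,ad,\,q,\,\alpha t,\,abcd\,\alpha t^{-1}q^{-1};q)_\infty}\,u(z,t,\alpha),$$ where $\alpha\in\{q/(ab),\,q/(ac),\,q/(ad)\}$ satisfies $\alpha q^k,\ ab\alpha q^k,\ ac\alpha q^k,\ ad\alpha q^k\ne1$ for all $k\ge0$. Finally let $\Phi_0=y$ and $\Phi_{n+1}(z,t)=[\mathcal A(z)E_q+{}^t\mathcal F(z;n)]\Phi_n(z,t)$, that is, $\Phi_n(z,t)=\prod_{i=0}^{n-1}[\mathcal A(z)E_q+{}^t\mathcal F(z;i)]\,y(z,t)$ with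 the factor $i=0$ acting first. Call $t\neq0$ admissible for $n$ and $\alpha$ if $\alpha tq^k\ne1$ and $abcd\,\alpha t^{-1}q^{k-1}\neq1$ for all $k\ge0$, and $t^2\ne abcd\,q^{2i}$ for $0\le i<n$ (no denominator in $y$ or in ${}^t\mathcal F(\cdot\,;i)$, $i<n$, vanishes). Call $z\ne0$ generic if none of $z^2,\ az,\ az^{-1},\ a\alpha z,\ a\alpha z^{-1}$ is an integer power of $q$. Then: 1. For all such $\alpha$, all $n\ge0$, all $t$ admissible for $n$ and $\alpha$, and all generic $z$, $$\mathcal L\,\Phi_n(z,t)={}^t\lambda(n)\,\Phi_n(z,t).$$ 2. Suppose that $abcd\,q^{k-1}\ne1$ for all $k\ge0$. Then there are nonzero constants $C_n$, $n\geq 0$ (independent of $z$, $t$ and $\alpha$), such that, for every such $\alpha$ which also satisfies $abcd\,\alpha q^{k-1}\neq1$ for all $k\ge0$ and every $n\ge0$, $$\lim_{t\to1}\Phi_n(z,t)=C_n\,P_n(\chi(z))\qquad\text{for every generic }z,$$ and for all $t$ in some neighbourhood of $1$, $t$ is admissible and $\Phi_n(\cdot,t)$ does not vanish identically on the generic points,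 so that it is an eigenfunction of $\mathcal L$ with eigenvalue ${}^t\lambda(n)$. -/

import Mathlib

open Filter Topology

noncomputable section

namespace AskeyWilson

/-- The finite `q`-shifted factorial `(σ; q)_k = ∏_{i<k} (1 - σ q^i)`. -/
def qPoch (σ q : ℂ) (k : ℕ) : ℂ := ∏ i ∈ Finset.range k, (1 - σ * q ^ i)

/-- The infinite `q`-shifted factorial `(σ; q)_∞` (convergent for `‖q‖ < 1`). -/
def qPochInf (σ q : ℂ) : ℂ := ∏' i : ℕ, (1 - σ * q ^ i)

/-- The basic hypergeometric series `₄φ₃(a₁, a₂, a₃, a₄; b₁, b₂, b₃ | q; z)`. -/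
def phi43 (a₁ a₂ a₃ a₄ b₁ b₂ b₃ q z : ℂ) : ℂ :=
  ∑' k : ℕ, qPoch a₁ q k * qPoch a₂ q k * qPoch a₃ q k * qPoch a₄ q k /
    (qPoch b₁ q k * qPoch b₂ q k * qPoch b₃ q k) * (z ^ k / qPoch q q k)

/-- The Askey-Wilson polynomial `P_n` evaluated at `χ(z) = (z + z⁻¹) / 2`, as a function of `z`. -/
def awPoly (q a b c d : ℂ) (n : ℕ) (z : ℂ) : ℂ :=
  qPoch (a * b) q n * qPoch (a * c) q n * qPoch (a * d) q n / a ^ n *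
    phi43 (q ^ (-(n : ℤ))) (a * b * c * d * q ^ ((n : ℤ) - 1)) (a * z) (a * z⁻¹)
      (a * b) (a * c) (a * d) q q

/-- The coefficient `v(z)` of the Askey-Wilson operator. -/
def vCoef (q a b c d z : ℂ) : ℂ :=
  (1 - a * z) * (1 - b * z) * (1 - c * z) * (1 - d * z) / ((1 - z ^ 2) * (1 - q * z ^ 2))

/-- The Askey-Wilson operator `v(z) E_q - (v(z) + v(z⁻¹)) + v(z⁻¹) E_q⁻¹`, `(E_q f)(z) = f(q z)`. -/
def awOp (q a b c d : ℂ) (f : ℂ → ℂ) (z : ℂ) : ℂ :=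
  vCoef q a b c d z * f (q * z) - (vCoef q a b c d z + vCoef q a b c d z⁻¹) * f z +
    vCoef q a b c d z⁻¹ * f (q⁻¹ * z)

/-- `ᵗλ(n) = -(1 - t q^{-n}) (1 - a b c d t⁻¹ q^{n-1})`. -/
def eigval (q a b c d t : ℂ) (n : ℤ) : ℂ :=
  -(1 - t * q ^ (-n)) * (1 - a * b * c * d * t⁻¹ * q ^ (n - 1))

/-! The coefficients `A_{-1}, A_0, A_1, A_2` (with `A_{-2} = 1`). -/

def coefAm1 (a b c d : ℂ) : ℂ := -(a + b + c + d)

def coefA0 (a b c d : ℂ) : ℂ := a * b + a * c + a * d + b * c + b * d + c * d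

def coefA1 (a b c d : ℂ) : ℂ := -(a * b * c + a * b * d + b * c * d + a * c * d)

def coefA2 (a b c d : ℂ) : ℂ := a * b * c * d

/-- The function `𝒜(z)`. -/
def funA (q a b c d z : ℂ) : ℂ :=
  (z⁻¹ ^ 2 + coefAm1 a b c d * z⁻¹ + coefA0 a b c d + coefA1 a b c d * z + coefA2 a b c d * z ^ 2) /
    (q * z - z⁻¹)

/-! The coefficients `β_0, F_{-2}, …, F_2`, with `λ(n)` replaced by `ᵗλ(n)`. -/

def coefFm2 (q a b c d t : ℂ) (n : ℤ) : ℂ :=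
  (eigval q a b c d t n - q * eigval q a b c d t (n + 1)) / (q ^ 2 - 1) -
    (q + coefA2 a b c d) / (q ^ 2 + q)

def coefF2 (q a b c d t : ℂ) (n : ℤ) : ℂ :=
  (eigval q a b c d t n * q - eigval q a b c d t (n + 1)) / (1 - q ^ 2) * q ^ 2 -
    (q ^ 2 + q * coefA2 a b c d) / (q + 1)

def coefBeta0 (q a b c d t : ℂ) (n : ℤ) : ℂ :=
  (1 - q) / ((eigval q a b c d t n - eigval q a b c d t (n + 1)) * q ^ 3) *
    ((2 * ((eigval q a b c d t n * q - eigval q a b c d t (n + 1)) / (1 - q ^ 2)) * q ^ 2 +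
        (eigval q a b c d t (n + 1) - eigval q a b c d t n) / (1 - q) * q ^ 2 -
        2 * ((q ^ 2 + q * coefA2 a b c d) / (1 + q))) *
        (coefA1 a b c d + q * coefAm1 a b c d) +
      (2 * coefA1 a b c d * q ^ 2 + 2 * coefA2 a b c d * coefAm1 a b c d * q))

def coefFm1 (q a b c d t : ℂ) (n : ℤ) : ℂ :=
  coefBeta0 q a b c d t n / 2 - (coefA1 a b c d + q * coefAm1 a b c d) / (2 * q)

def coefF1 (q a b c d t : ℂ) (n : ℤ) : ℂ :=
  -(q * coefBeta0 q a b c d t n) / 2 - (coefA1 a b c d + q * coefAm1 a b c d) / 2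

def coefF0 (q a b c d t : ℂ) (n : ℤ) : ℂ :=
  1 / (q + q ^ 2) *
    (q ^ 2 - q ^ 3 - coefA0 a b c d * (q + q ^ 2) + coefA2 a b c d * (q - 1) +
      q ^ 2 * (eigval q a b c d t n + eigval q a b c d t (n + 1)))

/-- The function `ᵗℱ(z; n)`. -/
def funF (q a b c d t : ℂ) (n : ℤ) (z : ℂ) : ℂ :=
  (coefFm2 q a b c d t n * z⁻¹ ^ 2 + coefFm1 q a b c d t n * z⁻¹ + coefF0 q a b c d t n +
    coefF1 q a b c d t n * z + coefF2 q a b c d t n * z ^ 2) / (q * z - z⁻¹)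

/-- The raising operator `𝒜(z) E_q + ᵗℱ(z; n)`. -/
def raiseOp (q a b c d t : ℂ) (n : ℤ) (f : ℂ → ℂ) (z : ℂ) : ℂ :=
  funA q a b c d z * f (q * z) + funF q a b c d t n z * f z

/-- The difference-hypergeometric function `u(z, t, α)`. -/
def uFun (q a b c d α t z : ℂ) : ℂ :=
  qPochInf (a * z) q * qPochInf (a * z⁻¹) q /
      (qPochInf (a * α * z) q * qPochInf (a * α * z⁻¹) q) *
    ∑' i : ℕ, qPoch (α * t) q i * qPoch (a * b * c * d * α * t⁻¹ * q⁻¹) q i *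
        qPoch (a * α * z) q i * qPoch (a * α * z⁻¹) q i /
      (qPoch (a * b * α) q i * qPoch (a * c * α) q i * qPoch (a * d * α) q i *
        qPoch (α * q) q i) * q ^ i

/-- The linear combination `y(z, t)` of `u(z, t, 1)` and `u(z, t, α)`. -/
def yFun (q a b c d α t z : ℂ) : ℂ :=
  uFun q a b c d 1 t z -
    α * (qPochInf t q * qPochInf (a * b * c * d * t⁻¹ * q⁻¹) q * qPochInf (a * b * α) q *
          qPochInf (a * c * α) q * qPochInf (a * d * α) q * qPochInf (α * q) q /
        (qPochInf (a * b) q * qPochInf (a * c) q * qPochInf (a * d) q * qPochInf q q *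
          qPochInf (α * t) q * qPochInf (a * b * c * d * α * t⁻¹ * q⁻¹) q)) *
      uFun q a b c d α t z

/-- `Φ_n(z, t)`: the raising operators with indices `0, 1, …, n - 1`, in this order,
applied to `y(z, t)`. -/
def Phi (q a b c d α t : ℂ) : ℕ → ℂ → ℂ
  | 0 => yFun q a b c d α t
  | n + 1 => raiseOp q a b c d t (n : ℤ) (Phi q a b c d α t n)

/-- `α` is one of `q/(ab)`, `q/(ac)`, `q/(ad)`, and `α ≠ 1` and the denominators
`(abα, acα, adα, αq; q)_i` in `u(z, t, α)` do not vanish. -/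
def AdmissibleAlpha (q a b c d α : ℂ) : Prop :=
  (a * b * α = q ∨ a * c * α = q ∨ a * d * α = q) ∧
    ∀ k : ℕ, a * b * α * q ^ k ≠ 1 ∧ a * c * α * q ^ k ≠ 1 ∧ a * d * α * q ^ k ≠ 1 ∧ α * q ^ k ≠ 1

/-- The denominators depending on `t` in the coefficient of `u(z, t, α)` in `y(z, t)` and in
`ᵗℱ(z; i)`, `i < n`, do not vanish (`ᵗλ(i) = ᵗλ(i+1)` exactly when `t² = a b c d q^{2i}`). -/
def AdmissibleT (q a b c d α : ℂ) (n : ℕ) (t : ℂ) : Prop :=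
  t ≠ 0 ∧ (∀ k : ℕ, α * t * q ^ k ≠ 1 ∧ a * b * c * d * α * t⁻¹ * q⁻¹ * q ^ k ≠ 1) ∧
    ∀ i : ℕ, i < n → t ^ 2 ≠ a * b * c * d * q ^ (2 * i)

/-- `z` avoids the singularities of the operators and of `u(·, t, 1)`, `u(·, t, α)` along its
orbit `{q^k z}`. -/
def GenericPoint (q a α z : ℂ) : Prop :=
  z ≠ 0 ∧ ∀ k : ℤ, z ^ 2 ≠ q ^ k ∧ a * z ≠ q ^ k ∧ a * z⁻¹ ≠ q ^ k ∧
    a * α * z ≠ q ^ k ∧ a * α * z⁻¹ ≠ q ^ k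

end AskeyWilson

end

/-! Part 1 is an induction on `n`. Write `L` for the Askey-Wilson operator and `R` for the raising
operator. If `f` is an eigenfunction for `ᵗλ(n)`, the eigenvalue equations at `z` and `qz` eliminate
`f(z/q)` and `f(q²z)` from `L(Rf)(z)`. The remaining coefficients of `f(qz)` and `f(z)` match those
of `ᵗλ(n+1) Rf` by three rational identities for `ᵗℱ` (`awOp_raiseOp`). These become mechanical once
everything is expressed through `s = t q⁻ⁿ` and `r = abcd / s`.

The base case rests on `awOp_psi`: `L` sends `psi_x` to a combination of `psi_x` and `psi_{x/q}`.
The coefficients of `u` solve the resulting two-term recurrence, so `(L - ᵗλ(0)) u` telescopes to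
two boundary terms (`awOp_uFun`). The lower one vanishes for `α = 1` and for `α = q/(ab), q/(ac),
q/(ad)`. The one at infinity is a constant times `(az, a/z; q)_∞`, the same function for every `α`,
and `y` is the combination in which these cancel.

For part 2, `y → 1` as `t → 1`, because `u(z,1,1) = 1` and the factor `(t; q)_∞` tends to `0`. Hence
`Φ_n` tends to the raising operators at `t = 1` applied to `1`. On eigenfunctions, `R = -q/(1-q²) (L
X - λ(n-1) X) + κ`, where `X` multiplies by `z + 1/z` (`exists_raiseOp_eq`). So `R` raises the
degree by one, with a leading coefficient proportional to `λ(n+1) - λ(n-1) ≠ 0`. The image of `P_n`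
is an eigenfunction for `λ(n+1)`. Since `L` is triangular in the basis `(az, a/z; q)_k` and `λ(n+1)`
differs from the earlier diagonal entries, that image is a nonzero multiple of `P_{n+1}`
(`exists_raiseOp_awPoly`). -/

noncomputable section

namespace AskeyWilson

/-! ### Rational identities between the coefficients of the two operators -/

/-- `(1 - a z)(1 - b z)(1 - c z)(1 - d z) / z ^ 2`, expanded, with `x` in the role of `z⁻¹`. -/
def numA (a b c d z x : ℂ) : ℂ :=
  x ^ 2 + coefAm1 a b c d * x + coefA0 a b c d + coefA1 a b c d * z + coefA2 a b c d * z ^ 2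

theorem vCoef_eq {q a b c d z : ℂ} (hz : z ≠ 0) (h1 : z ^ 2 ≠ 1) (h2 : q * z ^ 2 ≠ 1) :
    vCoef q a b c d z = numA a b c d z z⁻¹ / ((z - z⁻¹) * (q * z - z⁻¹)) := by
  have h1' : z ^ 2 - 1 ≠ 0 := sub_ne_zero.2 h1
  have h2' : q * z ^ 2 - 1 ≠ 0 := sub_ne_zero.2 h2
  have e1 : z - z⁻¹ = (z ^ 2 - 1) / z := by field_simp
  have e2 : q * z - z⁻¹ = (q * z ^ 2 - 1) / z := by field_simp
  have e3 : (1 - z ^ 2) * (1 - q * z ^ 2) = (z ^ 2 - 1) * (q * z ^ 2 - 1) := by ring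
  unfold vCoef numA coefAm1 coefA0 coefA1 coefA2
  rw [e1, e2, e3]
  field_simp
  ring

/-- `𝒜` keeps the numerator of `v` but only one of its two denominator factors. The surviving factor
`z - z⁻¹` is proportional to `χ(qz) - χ(z/q)`, which is what ties the raising operator to `L` and
multiplication by `χ`. -/
theorem funA_eq {q a b c d z : ℂ} (hz : z ≠ 0) (h1 : z ^ 2 ≠ 1) (h2 : q * z ^ 2 ≠ 1) :
    funA q a b c d z = vCoef q a b c d z * (z - z⁻¹) := by
  have h1' : z - z⁻¹ ≠ 0 := by
    have : z ^ 2 - 1 ≠ 0 := sub_ne_zero.2 h1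
    have e1 : z - z⁻¹ = (z ^ 2 - 1) / z := by field_simp
    rw [e1]; exact div_ne_zero this hz
  rw [vCoef_eq hz h1 h2]
  unfold funA numA
  field_simp

/-- The numerator of `funF` in terms of `s = t q⁻ⁿ` and `r = abcd / s`. -/
def numF (q s r e1 e2 e3 z x : ℂ) : ℂ :=
  -r / q * x ^ 2 + (-(r * (e3 + q * e1)) + e3 * q + r * s * e1) / (q * (s - r)) * x +
    (s + r - q - r * s / q - e2) +
    (s * (e3 + q * e1) - e3 * q - r * s * e1) / (s - r) * z - q * s * z ^ 2

/-- The eigenvalue depends on `t` and `n` only through `s` and `r`; raising `n` by one replaces `(s,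
r)` by `(s/q, qr)`. -/
theorem eigval_eq {q a b c d t s r : ℂ} {n : ℤ} (hq : q ≠ 0) (hs : s = t * q ^ (-n)) (hs0 : s ≠ 0)
    (hr : r = a * b * c * d / s) : eigval q a b c d t n = -(1 - s) * (1 - r / q) := by
  have hqn : q ^ n ≠ 0 := zpow_ne_zero _ hq
  have ht : t ≠ 0 := by rintro rfl; simp [hs] at hs0
  unfold eigval
  rw [hr, hs, zpow_sub_one₀ hq, zpow_neg]
  field_simp

theorem eigval_succ {q a b c d t s r : ℂ} {n : ℤ} (hq : q ≠ 0) (hs : s = t * q ^ (-n))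
    (hs0 : s ≠ 0) (hr : r = a * b * c * d / s) :
    eigval q a b c d t (n + 1) = -(1 - s / q) * (1 - r) := by
  rw [eigval_eq (s := s / q) (r := r * q) hq _ (div_ne_zero hs0 hq)]
  · field_simp
  · rw [hr]; field_simp
  · rw [hs, neg_add, zpow_add₀ hq]; simp [div_eq_mul_inv, mul_assoc]

theorem eigval_pred {q a b c d t s r : ℂ} {n : ℤ} (hq : q ≠ 0) (hs : s = t * q ^ (-n))
    (hs0 : s ≠ 0) (hr : r = a * b * c * d / s) :
    eigval q a b c d t (n - 1) = -(1 - s * q) * (1 - r / q ^ 2) := by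
  rw [eigval_eq (s := s * q) (r := r / q) hq _ (mul_ne_zero hs0 hq)]
  · field_simp
  · rw [hr]; field_simp
  · rw [hs, neg_sub, sub_eq_neg_add, zpow_add_one₀ hq, mul_assoc]

/-- The coefficients collapse in the variables `s, r`: `F_{-2} = -r/q`, `F_2 = -qs`, and since `λ -
λ' = -(1-q)(s-r)/q`, the only parameter-dependent denominator left by `β₀` is `s - r`, apart from
powers of `q`. -/
theorem funF_eq {q a b c d t s r : ℂ} {n : ℤ} (hq : q ≠ 0) (h1 : 1 - q ≠ 0) (h2 : 1 + q ≠ 0)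
    (hs : s = t * q ^ (-n)) (hs0 : s ≠ 0) (hr : r = a * b * c * d / s) (hsr : s - r ≠ 0) (z : ℂ) :
    funF q a b c d t n z =
      numF q s r (a + b + c + d) (coefA0 a b c d) (a * b * c + a * b * d + b * c * d + a * c * d)
        z z⁻¹ / (q * z - z⁻¹) := by
  have hl := eigval_eq (a := a) (b := b) (c := c) (d := d) hq hs hs0 hr
  have hl' := eigval_succ (a := a) (b := b) (c := c) (d := d) hq hs hs0 hr
  have e4 : coefA2 a b c d = r * s := by rw [hr, coefA2]; field_simp
  set l := eigval q a b c d t n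
  set l' := eigval q a b c d t (n + 1)
  have hd : l - l' = -(1 - q) * (s - r) / q := by rw [hl, hl']; field_simp; ring
  have hq1 : q ^ 2 - 1 = -(1 - q) * (1 + q) := by ring
  have hq2 : 1 - q ^ 2 = (1 - q) * (1 + q) := by ring
  have hq3 : q ^ 2 + q = q * (1 + q) := by ring
  have hq4 : q + q ^ 2 = q * (1 + q) := by ring
  have hq5 : q + 1 = 1 + q := by ring
  have Fm2 : coefFm2 q a b c d t n = -r / q := by
    unfold coefFm2
    change (l - q * l') / _ - _ = _
    rw [hl, hl', e4, hq1, hq3]; field_simp; ring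
  have F2 : coefF2 q a b c d t n = - (q * s) := by
    unfold coefF2
    change (l * q - l') / _ * _ - _ = _
    rw [hl, hl', e4, hq2, hq5]; field_simp; ring
  have B0 : coefBeta0 q a b c d t n = ((s + r) * (coefA1 a b c d + q * coefAm1 a b c d) -
      2 * coefA1 a b c d * q - 2 * r * s * coefAm1 a b c d) / (q * (s - r)) := by
    unfold coefBeta0
    change (1 - q) / ((l - l') * _) * ((2 * ((l * q - l') / _) * _ + (l' - l) / _ * _ - _) * _ + _)
      = _
    rw [← neg_sub l l', hd, hq2, hl, hl', e4]
    field_simp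
    ring
  have F0 : coefF0 q a b c d t n = s + r - q - r * s / q - coefA0 a b c d := by
    unfold coefF0
    change _ * (_ + _ * (l + l')) = _
    rw [hl, hl', e4, hq4]; field_simp; ring
  unfold funF coefFm1 coefF1 numF
  rw [Fm2, F2, B0, F0]
  congr 1
  unfold coefA1 coefAm1
  field_simp
  ring

/-- `numA` in terms of elementary symmetric functions, with `abcd = r s`. -/
def numA' (s r e1 e2 e3 z x : ℂ) : ℂ :=
  x ^ 2 - e1 * x + e2 - e3 * z + r * s * z ^ 2

/-- This and the next two identities are `funF_inv_sub`, `funF_shift` and `funF_quad` with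
denominators cleared. With `abcd` replaced by `rs`, the quantities `s, r, e1, e2, e3, z, q` can be
treated as independent variables. -/
theorem numF_symm {q s r e1 e2 e3 z : ℂ} (hq : q ≠ 0) (hz : z ≠ 0) (hsr : s - r ≠ 0) :
    numF q s r e1 e2 e3 z⁻¹ z * (q * z - z⁻¹) + numF q s r e1 e2 e3 z z⁻¹ * (z - q * z⁻¹) +
      (z - z⁻¹) * (-(1 - s) * (1 - r / q)) * (q * z - z⁻¹) * (z - q * z⁻¹) +
      numA' s r e1 e2 e3 z z⁻¹ * (z - q * z⁻¹) + numA' s r e1 e2 e3 z⁻¹ z * (q * z - z⁻¹) = 0 := by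
  unfold numF numA'
  field_simp
  ring

theorem numF_shift {q s r e1 e2 e3 z : ℂ} (hq : q ≠ 0) (hz : z ≠ 0) (hsr : s - r ≠ 0) :
    (numF q s r e1 e2 e3 z z⁻¹ - numF q s r e1 e2 e3 (q⁻¹ * z⁻¹) (q * z)) * (z - q * z⁻¹) -
    (numF q s r e1 e2 e3 (q⁻¹ * z) (q * z⁻¹) - numF q s r e1 e2 e3 z⁻¹ z) * (q * z - z⁻¹) =
    (-(1 - s / q) * (1 - r) - -(1 - s) * (1 - r / q)) * (z - z⁻¹) * (q * z - z⁻¹) *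
      (z - q * z⁻¹) := by
  unfold numF
  field_simp
  ring

theorem numF_quad {q s r e1 e2 e3 z : ℂ} (hq : q ≠ 0) (hz : z ≠ 0) (hsr : s - r ≠ 0) :
    -numA' s r e1 e2 e3 z z⁻¹ * numA' s r e1 e2 e3 (q⁻¹ * z⁻¹) (q * z) * (z - q * z⁻¹) ^ 2 +
    numA' s r e1 e2 e3 z⁻¹ z * numA' s r e1 e2 e3 (q⁻¹ * z) (q * z⁻¹) * (q * z - z⁻¹) ^ 2 -
    (numA' s r e1 e2 e3 z z⁻¹ * (z - q * z⁻¹) + numA' s r e1 e2 e3 z⁻¹ z * (q * z - z⁻¹) +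
      -(1 - s / q) * (1 - r) * (z - z⁻¹) * (q * z - z⁻¹) * (z - q * z⁻¹)) *
        numF q s r e1 e2 e3 z z⁻¹ * (z - q * z⁻¹) +
    (numA' s r e1 e2 e3 z z⁻¹ * (z - q * z⁻¹) + numA' s r e1 e2 e3 z⁻¹ z * (q * z - z⁻¹) +
      -(1 - s) * (1 - r / q) * (z - z⁻¹) * (q * z - z⁻¹) * (z - q * z⁻¹)) *
        numF q s r e1 e2 e3 (q⁻¹ * z) (q * z⁻¹) * (q * z - z⁻¹) = 0 := by
  unfold numF numA'
  field_simp
  ring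

/-! ### Regular points of the operators -/

/-- No point of the orbit `{q^k z}` is a singularity of `vCoef`. -/
def RegularPoint (q z : ℂ) : Prop := z ≠ 0 ∧ ∀ k : ℤ, z ^ 2 ≠ q ^ k

theorem RegularPoint.mul_zpow {q z : ℂ} (hq : q ≠ 0) (h : RegularPoint q z) (j : ℤ) :
    RegularPoint q (q ^ j * z) := by
  refine ⟨mul_ne_zero (zpow_ne_zero _ hq) h.1, fun k hk => h.2 (k - 2 * j) ?_⟩
  have := zpow_ne_zero j hq
  rw [zpow_sub₀ hq, ← hk, mul_comm 2 j, zpow_mul, zpow_ofNat]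
  field_simp

theorem RegularPoint.mul_left {q z : ℂ} (hq : q ≠ 0) (h : RegularPoint q z) :
    RegularPoint q (q * z) := by
  simpa using h.mul_zpow hq 1

theorem RegularPoint.inv_mul_left {q z : ℂ} (hq : q ≠ 0) (h : RegularPoint q z) :
    RegularPoint q (q⁻¹ * z) := by
  simpa using h.mul_zpow hq (-1)

theorem RegularPoint.inv {q z : ℂ} (h : RegularPoint q z) : RegularPoint q z⁻¹ := by
  refine ⟨inv_ne_zero h.1, fun k hk => h.2 (-k) ?_⟩
  rw [zpow_neg, ← hk, inv_pow, inv_inv]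

theorem RegularPoint.sq_ne_one {q z : ℂ} (h : RegularPoint q z) : z ^ 2 ≠ 1 := by
  simpa using h.2 0

theorem RegularPoint.mul_sq_ne_one {q z : ℂ} (h : RegularPoint q z) :
    q * z ^ 2 ≠ 1 := by
  intro hk
  apply h.2 (-1)
  rw [zpow_neg_one]
  exact eq_inv_of_mul_eq_one_right hk

theorem RegularPoint.sub_inv_ne_zero {q z : ℂ} (h : RegularPoint q z) : z - z⁻¹ ≠ 0 := by
  have : z ^ 2 - 1 ≠ 0 := sub_ne_zero.2 h.sq_ne_one
  have hz := h.1
  rw [show z - z⁻¹ = (z ^ 2 - 1) / z by field_simp]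
  exact div_ne_zero this h.1

theorem RegularPoint.mul_sub_inv_ne_zero {q z : ℂ} (h : RegularPoint q z) :
    q * z - z⁻¹ ≠ 0 := by
  have : q * z ^ 2 - 1 ≠ 0 := sub_ne_zero.2 h.mul_sq_ne_one
  have hz := h.1
  rw [show q * z - z⁻¹ = (q * z ^ 2 - 1) / z by field_simp]
  exact div_ne_zero this h.1

theorem RegularPoint.sub_mul_inv_ne_zero {q z : ℂ} (h : RegularPoint q z) :
    z - q * z⁻¹ ≠ 0 := by
  have := h.inv.mul_sub_inv_ne_zero
  rw [inv_inv] at this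
  intro h0
  exact this (by linear_combination -h0)

theorem numA_eq_numA' {a b c d s r : ℂ} (h4 : a * b * c * d = r * s) (z x : ℂ) :
    numA a b c d z x = numA' s r (a + b + c + d) (coefA0 a b c d)
      (a * b * c + a * b * d + b * c * d + a * c * d) z x := by
  unfold numA numA' coefAm1 coefA1 coefA2
  rw [h4]; ring

theorem RegularPoint.vCoef_eq {q a b c d z : ℂ} (h : RegularPoint q z) :
    vCoef q a b c d z = numA a b c d z z⁻¹ / ((z - z⁻¹) * (q * z - z⁻¹)) :=
  AskeyWilson.vCoef_eq h.1 h.sq_ne_one h.mul_sq_ne_one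

theorem RegularPoint.vCoef_inv_eq {q a b c d z : ℂ} (h : RegularPoint q z) :
    vCoef q a b c d z⁻¹ = numA a b c d z⁻¹ z / ((z - z⁻¹) * (z - q * z⁻¹)) := by
  rw [h.inv.vCoef_eq, inv_inv]
  congr 1; ring

theorem RegularPoint.funA_eq {q a b c d z : ℂ} (h : RegularPoint q z) :
    funA q a b c d z = vCoef q a b c d z * (z - z⁻¹) :=
  AskeyWilson.funA_eq h.1 h.sq_ne_one h.mul_sq_ne_one

/-! ### The raising operator intertwines consecutive eigenvalues -/

section

variable {q a b c d t : ℂ} {n : ℤ}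

/-- The admissibility condition on `t²` says exactly that `s ≠ r`. -/
theorem exists_spectral_param (hq : q ≠ 0) (ht : t ≠ 0) (hn : t ^ 2 ≠ a * b * c * d * q ^ (2 * n)) :
    ∃ s r : ℂ, s = t * q ^ (-n) ∧ s ≠ 0 ∧ r = a * b * c * d / s ∧ s - r ≠ 0 ∧
      a * b * c * d = r * s := by
  have hqn : q ^ n ≠ 0 := zpow_ne_zero _ hq
  have hs : t * q ^ (-n) ≠ 0 := mul_ne_zero ht (zpow_ne_zero _ hq)
  refine ⟨t * q ^ (-n), _, rfl, hs, rfl, fun h => hn ?_, ?_⟩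
  · rw [sub_eq_zero, eq_div_iff hs, zpow_neg] at h
    rw [mul_comm 2 n, zpow_mul, zpow_ofNat, ← h]
    field_simp
  · field_simp

theorem funF_inv_sub (hq : q ≠ 0) (h1 : 1 - q ≠ 0) (h2 : 1 + q ≠ 0) (ht : t ≠ 0)
    (hn : t ^ 2 ≠ a * b * c * d * q ^ (2 * n)) {z : ℂ} (hz : RegularPoint q z) :
    funF q a b c d t n z⁻¹ - funF q a b c d t n z =
      (z - z⁻¹) * (eigval q a b c d t n + vCoef q a b c d z + vCoef q a b c d z⁻¹) := by
  obtain ⟨s, r, hs, hs0, hr, hsr, h4⟩ := exists_spectral_param hq ht hn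
  have hw := hz.sub_inv_ne_zero
  have hd1 := hz.mul_sub_inv_ne_zero
  have hd2 := hz.sub_mul_inv_ne_zero
  have key := numF_symm (e1 := a + b + c + d) (e2 := coefA0 a b c d)
    (e3 := a * b * c + a * b * d + b * c * d + a * c * d) hq hz.1 hsr
  rw [funF_eq hq h1 h2 hs hs0 hr hsr, funF_eq hq h1 h2 hs hs0 hr hsr, eigval_eq hq hs hs0 hr,
    hz.vCoef_eq, hz.vCoef_inv_eq, numA_eq_numA' h4, numA_eq_numA' h4, inv_inv,
    show q * z⁻¹ - z = -(z - q * z⁻¹) by ring]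
  -- With every block made an atom, clearing denominators leaves an expression linear in `key`.
  generalize -(1 - s) * (1 - r / q) = l at *
  generalize numF _ _ _ _ _ _ z⁻¹ z = N1 at *
  generalize numF _ _ _ _ _ _ z z⁻¹ = N2 at *
  generalize numA' _ _ _ _ _ z⁻¹ z = B1 at *
  generalize numA' _ _ _ _ _ z z⁻¹ = B2 at *
  generalize q * z - z⁻¹ = D1 at *
  generalize z - q * z⁻¹ = D2 at *
  generalize z - z⁻¹ = w at *
  field_simp
  linear_combination -key

theorem funF_shift (hq : q ≠ 0) (h1 : 1 - q ≠ 0) (h2 : 1 + q ≠ 0) (ht : t ≠ 0)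
    (hn : t ^ 2 ≠ a * b * c * d * q ^ (2 * n)) {z : ℂ} (hz : RegularPoint q z) :
    funF q a b c d t n z - funF q a b c d t n (q⁻¹ * z) + funF q a b c d t n (q * z)⁻¹ -
        funF q a b c d t n z⁻¹ =
      (eigval q a b c d t (n + 1) - eigval q a b c d t n) * (z - z⁻¹) := by
  obtain ⟨s, r, hs, hs0, hr, hsr, h4⟩ := exists_spectral_param hq ht hn
  have hd1 := hz.mul_sub_inv_ne_zero
  have hd2 := hz.sub_mul_inv_ne_zero
  have key := numF_shift (e1 := a + b + c + d) (e2 := coefA0 a b c d)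
    (e3 := a * b * c + a * b * d + b * c * d + a * c * d) hq hz.1 hsr
  simp only [funF_eq hq h1 h2 hs hs0 hr hsr, eigval_eq hq hs hs0 hr, eigval_succ hq hs hs0 hr]
  rw [inv_inv, inv_inv, mul_inv, mul_inv, inv_inv, mul_inv_cancel_left₀ hq,
    mul_inv_cancel_left₀ hq, show q * z⁻¹ - z = -(z - q * z⁻¹) by ring,
    show z⁻¹ - q * z = -(q * z - z⁻¹) by ring]
  generalize -(1 - s) * (1 - r / q) = l at *
  generalize -(1 - s / q) * (1 - r) = l' at *
  generalize numF _ _ _ _ _ _ z⁻¹ z = N1 at *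
  generalize numF _ _ _ _ _ _ z z⁻¹ = N2 at *
  generalize numF _ _ _ _ _ _ (q⁻¹ * z) (q * z⁻¹) = N3 at *
  generalize numF _ _ _ _ _ _ (q⁻¹ * z⁻¹) (q * z) = N4 at *
  generalize q * z - z⁻¹ = D1 at *
  generalize z - q * z⁻¹ = D2 at *
  generalize z - z⁻¹ = w at *
  field_simp
  linear_combination key

theorem funF_quad (hq : q ≠ 0) (h1 : 1 - q ≠ 0) (h2 : 1 + q ≠ 0) (ht : t ≠ 0)
    (hn : t ^ 2 ≠ a * b * c * d * q ^ (2 * n)) {z : ℂ} (hz : RegularPoint q z) :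
    -vCoef q a b c d z * vCoef q a b c d (q * z)⁻¹ * (q * z - (q * z)⁻¹) -
      (vCoef q a b c d z + vCoef q a b c d z⁻¹ + eigval q a b c d t (n + 1)) *
        funF q a b c d t n z +
      vCoef q a b c d z⁻¹ * vCoef q a b c d (q⁻¹ * z) * (q⁻¹ * z - (q⁻¹ * z)⁻¹) +
      funF q a b c d t n (q⁻¹ * z) *
        (eigval q a b c d t n + vCoef q a b c d z + vCoef q a b c d z⁻¹) = 0 := by
  obtain ⟨s, r, hs, hs0, hr, hsr, h4⟩ := exists_spectral_param hq ht hn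
  have hw := hz.sub_inv_ne_zero
  have hd1 := hz.mul_sub_inv_ne_zero
  have hd2 := hz.sub_mul_inv_ne_zero
  have hw1 := (hz.mul_left hq).sub_inv_ne_zero
  have hw2 := (hz.inv_mul_left hq).sub_inv_ne_zero
  have key := numF_quad (e1 := a + b + c + d) (e2 := coefA0 a b c d)
    (e3 := a * b * c + a * b * d + b * c * d + a * c * d) hq hz.1 hsr
  rw [(hz.mul_left hq).vCoef_inv_eq, (hz.inv_mul_left hq).vCoef_eq, hz.vCoef_eq,
    hz.vCoef_inv_eq]
  simp only [funF_eq hq h1 h2 hs hs0 hr hsr, eigval_eq hq hs hs0 hr, eigval_succ hq hs hs0 hr,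
    numA_eq_numA' h4]
  rw [mul_inv, mul_inv, inv_inv] at *
  rw [mul_inv_cancel_left₀ hq, mul_inv_cancel_left₀ hq]
  generalize -(1 - s) * (1 - r / q) = l at *
  generalize -(1 - s / q) * (1 - r) = l' at *
  generalize numF _ _ _ _ _ _ z z⁻¹ = N2 at *
  generalize numF _ _ _ _ _ _ (q⁻¹ * z) (q * z⁻¹) = N3 at *
  generalize numA' _ _ _ _ _ z⁻¹ z = B1 at *
  generalize numA' _ _ _ _ _ z z⁻¹ = B2 at *
  generalize numA' _ _ _ _ _ (q⁻¹ * z⁻¹) (q * z) = B3 at *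
  generalize numA' _ _ _ _ _ (q⁻¹ * z) (q * z⁻¹) = B4 at *
  generalize q * z - z⁻¹ = D1 at *
  generalize z - q * z⁻¹ = D2 at *
  generalize z - z⁻¹ = w at *
  generalize q * z - q⁻¹ * z⁻¹ = w1 at *
  generalize q⁻¹ * z - q * z⁻¹ = w2 at *
  field_simp
  linear_combination key

/-- The raising operator maps eigenfunctions of `awOp` for `ᵗλ(n)` to eigenfunctions for
`ᵗλ(n + 1)`. -/
theorem awOp_raiseOp (hq : q ≠ 0) (h1 : 1 - q ≠ 0) (h2 : 1 + q ≠ 0) (ht : t ≠ 0)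
    (hn : t ^ 2 ≠ a * b * c * d * q ^ (2 * n)) {z : ℂ} (hz : RegularPoint q z) {f : ℂ → ℂ}
    (hf : awOp q a b c d f z = eigval q a b c d t n * f z)
    (hf' : awOp q a b c d f (q * z) = eigval q a b c d t n * f (q * z)) :
    awOp q a b c d (raiseOp q a b c d t n f) z =
      eigval q a b c d t (n + 1) * raiseOp q a b c d t n f z := by
  have I0 := funF_shift (a := a) (b := b) (c := c) (d := d) hq h1 h2 ht hn hz
  have I1 := funF_inv_sub (a := a) (b := b) (c := c) (d := d) hq h1 h2 ht hn hz
  have I2 := funF_inv_sub (a := a) (b := b) (c := c) (d := d) hq h1 h2 ht hn (hz.mul_left hq)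
  have I3 := funF_quad (a := a) (b := b) (c := c) (d := d) hq h1 h2 ht hn hz
  unfold awOp raiseOp at *
  rw [(hz.mul_left hq).funA_eq, hz.funA_eq, (hz.inv_mul_left hq).funA_eq,
    mul_inv_cancel_left₀ hq]
  rw [inv_mul_cancel_left₀ hq] at hf'
  -- `hf'` eliminates `f(q²z)` and `hf` eliminates `f(z/q)`. The coefficient of `f(z)` is then `I3`,
  -- and that of `f(qz)` is `v(z)` times `I0 + I1 - I2`.
  linear_combination vCoef q a b c d z * (q * z - (q * z)⁻¹) * hf' +
    funF q a b c d t n (q⁻¹ * z) * hf + f z * I3 +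
    vCoef q a b c d z * f (q * z) * (I0 + I1 - I2)

end

/-! ### Finite and infinite `q`-shifted factorials -/

theorem one_add_ne_zero_of_norm_lt_one {q : ℂ} (hq : ‖q‖ < 1) : 1 + q ≠ 0 := fun h => by
  rw [eq_neg_iff_add_eq_zero.2 ((add_comm _ _).trans h)] at hq; simp at hq

theorem one_sub_ne_zero_of_norm_lt_one {q : ℂ} (hq : ‖q‖ < 1) : 1 - q ≠ 0 :=
  sub_ne_zero.2 (by rintro rfl; simp at hq)

theorem pow_ne_one_of_norm_lt_one {q : ℂ} (hq : ‖q‖ < 1) {k : ℕ} (hk : k ≠ 0) : q ^ k ≠ 1 := fun h => by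
  have := congrArg norm h
  rw [norm_pow, norm_one] at this
  exact (pow_lt_one₀ (norm_nonneg _) hq hk).ne this

theorem qPoch_zero (σ q : ℂ) : qPoch σ q 0 = 1 := by simp [qPoch]

theorem qPoch_succ (σ q : ℂ) (k : ℕ) : qPoch σ q (k + 1) = qPoch σ q k * (1 - σ * q ^ k) :=
  Finset.prod_range_succ _ _

theorem qPoch_add (σ q : ℂ) (k m : ℕ) :
    qPoch σ q (k + m) = qPoch σ q k * qPoch (σ * q ^ k) q m := by
  unfold qPoch
  rw [Finset.prod_range_add]
  simp only [pow_add, mul_assoc]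

theorem qPoch_ne_zero {σ q : ℂ} (h : ∀ k : ℕ, σ * q ^ k ≠ 1) (k : ℕ) : qPoch σ q k ≠ 0 :=
  Finset.prod_ne_zero_iff.2 fun i _ => sub_ne_zero.2 (h i).symm

theorem qPoch_eq_zero {σ q : ℂ} {j k : ℕ} (h : σ * q ^ j = 1) (hjk : j < k) : qPoch σ q k = 0 :=
  Finset.prod_eq_zero (Finset.mem_range.2 hjk) (by rw [h, sub_self])

theorem continuous_qPoch (q : ℂ) (k : ℕ) : Continuous fun σ => qPoch σ q k := by
  unfold qPoch; fun_prop

section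

variable {q : ℂ} (hq : ‖q‖ < 1)

include hq

theorem summable_norm_mul_pow (σ : ℂ) : Summable fun i : ℕ => ‖-(σ * q ^ i)‖ := by
  simp only [norm_neg, norm_mul, norm_pow]
  exact (summable_geometric_of_lt_one (norm_nonneg _) hq).mul_left _

theorem tendsto_qPoch (σ : ℂ) : Tendsto (qPoch σ q) atTop (𝓝 (qPochInf σ q)) := by
  have := (multipliable_one_add_of_summable (summable_norm_mul_pow hq σ)).hasProd.tendsto_prod_nat
  simp only [← sub_eq_add_neg] at this
  exact this

theorem qPoch_mul_qPochInf (σ : ℂ) (k : ℕ) :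
    qPoch σ q k * qPochInf (σ * q ^ k) q = qPochInf σ q := by
  have h1 := (tendsto_qPoch hq (σ * q ^ k)).const_mul (qPoch σ q k)
  have h2 := (tendsto_add_atTop_iff_nat k).2 (tendsto_qPoch hq σ)
  refine tendsto_nhds_unique (h1.congr fun m => ?_) h2
  rw [add_comm, qPoch_add]

theorem qPochInf_eq (σ : ℂ) : qPochInf σ q = (1 - σ) * qPochInf (σ * q) q := by
  simpa [qPoch] using (qPoch_mul_qPochInf hq σ 1).symm

theorem qPochInf_ne_zero {σ : ℂ} (h : ∀ k : ℕ, σ * q ^ k ≠ 1) : qPochInf σ q ≠ 0 := by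
  have := tprod_one_add_ne_zero_of_summable (f := fun i : ℕ => -(σ * q ^ i))
    (fun i => by rw [← sub_eq_add_neg]; exact sub_ne_zero.2 (h i).symm)
    (summable_norm_mul_pow hq σ)
  simp only [← sub_eq_add_neg] at this
  exact this

theorem qPochInf_eq_zero {σ : ℂ} {j : ℕ} (h : σ * q ^ j = 1) : qPochInf σ q = 0 := by
  rw [← qPoch_mul_qPochInf hq σ (j + 1), qPoch_eq_zero h (Nat.lt_succ_self j), zero_mul]

/-- Follows from `1 + x ≤ exp x` and the geometric series. The bound is uniform in `k` and monotone
in `‖σ‖`, as dominated convergence in `t` requires later. -/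
theorem norm_qPoch_le (σ : ℂ) (k : ℕ) : ‖qPoch σ q k‖ ≤ Real.exp (‖σ‖ * (1 - ‖q‖)⁻¹) := by
  have hs := summable_geometric_of_lt_one (norm_nonneg q) hq
  calc ‖qPoch σ q k‖ ≤ ∏ i ∈ Finset.range k, Real.exp (‖σ‖ * ‖q‖ ^ i) := by
        unfold qPoch
        rw [norm_prod]
        refine Finset.prod_le_prod (fun _ _ => norm_nonneg _) fun i _ => ?_
        calc ‖1 - σ * q ^ i‖ ≤ 1 + ‖σ‖ * ‖q‖ ^ i := by
              simpa using norm_sub_le (1 : ℂ) (σ * q ^ i)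
          _ ≤ _ := by rw [add_comm]; exact Real.add_one_le_exp _
    _ = Real.exp (‖σ‖ * ∑ i ∈ Finset.range k, ‖q‖ ^ i) := by
        rw [← Real.exp_sum, Finset.mul_sum]
    _ ≤ _ := by
        rw [← tsum_geometric_of_lt_one (norm_nonneg q) hq]
        gcongr
        exact hs.sum_le_tsum _ fun _ _ => by positivity

/-- The product converges locally uniformly in `σ`: on a ball around `σ₀` its terms are dominated by
one geometric series. -/
theorem continuous_qPochInf : Continuous fun σ => qPochInf σ q := by
  refine continuous_iff_continuousAt.2 fun σ₀ => ?_
  have hK : IsOpen (Metric.ball (0 : ℂ) (‖σ₀‖ + 1)) := Metric.isOpen_ball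
  have hu : Summable fun i : ℕ => (‖σ₀‖ + 1) * ‖q‖ ^ i :=
    (summable_geometric_of_lt_one (norm_nonneg _) hq).mul_left _
  have h := hu.hasProdLocallyUniformlyOn_nat_one_add (f := fun (i : ℕ) (σ : ℂ) => -(σ * q ^ i)) hK
    (Eventually.of_forall fun i σ hσ => by
      rw [norm_neg, norm_mul, norm_pow]
      gcongr
      simpa using (mem_ball_zero_iff.1 hσ).le)
    (fun i => by fun_prop)
  have hc := h.tendstoLocallyUniformlyOn_finsetRange.continuousOn
    (Eventually.of_forall fun n => by fun_prop).frequently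
  have := hc.continuousAt (hK.mem_nhds (by simp : σ₀ ∈ Metric.ball (0 : ℂ) (‖σ₀‖ + 1)))
  simp only [← sub_eq_add_neg] at this
  exact this

end

/-! ### Stability of generic points under shifts and inversion -/

theorem GenericPoint.regular {q a α z : ℂ} (h : GenericPoint q a α z) : RegularPoint q z :=
  ⟨h.1, fun k => (h.2 k).1⟩

theorem GenericPoint.mul_left {q a α z : ℂ} (hq : q ≠ 0) (h : GenericPoint q a α z) :
    GenericPoint q a α (q * z) := by
  have hr := h.regular.mul_left hq
  refine ⟨hr.1, fun k => ⟨hr.2 k, fun hk => (h.2 (k - 1)).2.1 ?_, fun hk => (h.2 (k + 1)).2.2.1 ?_,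
    fun hk => (h.2 (k - 1)).2.2.2.1 ?_, fun hk => (h.2 (k + 1)).2.2.2.2 ?_⟩⟩
  · rw [zpow_sub_one₀ hq, ← hk]; field_simp
  · rw [zpow_add_one₀ hq, ← hk]; field_simp
  · rw [zpow_sub_one₀ hq, ← hk]; field_simp
  · rw [zpow_add_one₀ hq, ← hk]; field_simp

theorem GenericPoint.inv {q a α z : ℂ} (h : GenericPoint q a α z) : GenericPoint q a α z⁻¹ := by
  have hr := h.regular.inv
  exact ⟨hr.1, fun k => ⟨hr.2 k, (h.2 k).2.2.1, by simpa using (h.2 k).2.1, (h.2 k).2.2.2.2,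
    by simpa using (h.2 k).2.2.2.1⟩⟩

theorem GenericPoint.inv_mul_left {q a α z : ℂ} (hq : q ≠ 0) (h : GenericPoint q a α z) :
    GenericPoint q a α (q⁻¹ * z) := by
  simpa [mul_inv, mul_comm] using (h.inv.mul_left hq).inv

theorem GenericPoint.mul_zpow {q a α z : ℂ} (hq : q ≠ 0) (h : GenericPoint q a α z) (j : ℤ) :
    GenericPoint q a (α * q ^ j) z := by
  have hj := zpow_ne_zero j hq
  refine ⟨h.1, fun k => ⟨(h.2 k).1, (h.2 k).2.1, (h.2 k).2.2.1,
    fun hk => (h.2 (k - j)).2.2.2.1 ?_, fun hk => (h.2 (k - j)).2.2.2.2 ?_⟩⟩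
  · rw [zpow_sub₀ hq, ← hk]; field_simp
  · rw [zpow_sub₀ hq, ← hk]; field_simp

theorem GenericPoint.ne_one {q a α z : ℂ} (h : GenericPoint q a α z) (k : ℤ) :
    a * z * q ^ k ≠ 1 ∧ a * z⁻¹ * q ^ k ≠ 1 ∧ a * α * z * q ^ k ≠ 1 ∧ a * α * z⁻¹ * q ^ k ≠ 1 := by
  have key : ∀ x : ℂ, x ≠ q ^ (-k) → x * q ^ k ≠ 1 := fun x hx h1 => hx (by
    rw [zpow_neg]; exact eq_inv_of_mul_eq_one_left h1)
  have := h.2 (-k)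
  exact ⟨key _ this.2.1, key _ this.2.2.1, key _ this.2.2.2.1, key _ this.2.2.2.2⟩

/-! ### Bidiagonal action of the Askey-Wilson operator on `psi` -/

/-- `(az, a/z; q)_∞ / (axz, ax/z; q)_∞`; for `x = q^k` this is `(az, a/z; q)_k`. -/
def psi (q a x z : ℂ) : ℂ :=
  qPochInf (a * z) q * qPochInf (a * z⁻¹) q / (qPochInf (a * x * z) q * qPochInf (a * x * z⁻¹) q)

/-- The coefficient of `psi q a (q⁻¹ * x)` in the action of the Askey-Wilson operator on
`psi q a x`. -/
def lowerCoef (q a b c d x : ℂ) : ℂ :=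
  (1 - x⁻¹) * (1 - a * b * x * q⁻¹) * (1 - a * c * x * q⁻¹) * (1 - a * d * x * q⁻¹)

/-- This is `awOp_psi` after division by `psi q a (q⁻¹ * x) z`. The factors `1 - az` and `1 - a/z`
produced by shifting `(az, a/z; q)_∞` cancel against those in `v(z)` and `v(1/z)`. -/
theorem vCoef_psi_identity {q a b c d x z : ℂ} (hq : q ≠ 0) (hz : RegularPoint q z) (hx : x ≠ 0)
    (h1 : 1 - a * z ≠ 0) (h2 : 1 - a * z⁻¹ ≠ 0) :
    vCoef q a b c d z / (1 - a * z) * (1 - a * q⁻¹ * z⁻¹) * (1 - a * x * q⁻¹ * z) *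
        (1 - a * x * z) -
      (vCoef q a b c d z + vCoef q a b c d z⁻¹) * (1 - a * x * q⁻¹ * z) * (1 - a * x * q⁻¹ * z⁻¹) +
      vCoef q a b c d z⁻¹ / (1 - a * z⁻¹) * (1 - a * q⁻¹ * z) * (1 - a * x * q⁻¹ * z⁻¹) *
        (1 - a * x * z⁻¹) =
    -(1 - x⁻¹) * (1 - a * b * c * d * x * q⁻¹) *
      ((1 - a * x * q⁻¹ * z) * (1 - a * x * q⁻¹ * z⁻¹)) + lowerCoef q a b c d x := by
  have hz0 := hz.1
  have e1 : 1 - z ^ 2 ≠ 0 := sub_ne_zero.2 hz.sq_ne_one.symm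
  have e2 : 1 - q * z ^ 2 ≠ 0 := sub_ne_zero.2 hz.mul_sq_ne_one.symm
  have e3 : z ^ 2 - q ≠ 0 := sub_ne_zero.2 (by simpa using hz.2 1)
  have e4 : z - a ≠ 0 := by
    intro h; apply h2
    rw [sub_eq_zero] at h
    rw [← h]; field_simp; simp
  have v1 : vCoef q a b c d z / (1 - a * z) =
      (1 - b * z) * (1 - c * z) * (1 - d * z) / ((1 - z ^ 2) * (1 - q * z ^ 2)) := by
    unfold vCoef; field_simp
  have v2' : vCoef q a b c d z⁻¹ =
      -((z - a) * (z - b) * (z - c) * (z - d)) / ((1 - z ^ 2) * (z ^ 2 - q)) := by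
    unfold vCoef
    have : (1 - z⁻¹ ^ 2) * (1 - q * z⁻¹ ^ 2) = -((1 - z ^ 2) * (z ^ 2 - q)) / z ^ 4 := by
      field_simp; ring
    rw [this]
    field_simp
  have v2 : vCoef q a b c d z⁻¹ / (1 - a * z⁻¹) =
      -(z * (z - b) * (z - c) * (z - d)) / ((1 - z ^ 2) * (z ^ 2 - q)) := by
    rw [v2', show 1 - a * z⁻¹ = (z - a) / z by field_simp]
    field_simp
  rw [v1, v2, v2']
  unfold vCoef lowerCoef
  obtain ⟨D1, hD1⟩ : ∃ D, D = 1 - z ^ 2 := ⟨_, rfl⟩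
  obtain ⟨D2, hD2⟩ : ∃ D, D = 1 - q * z ^ 2 := ⟨_, rfl⟩
  obtain ⟨D3, hD3⟩ : ∃ D, D = z ^ 2 - q := ⟨_, rfl⟩
  rw [← hD1] at e1 ⊢
  rw [← hD2] at e2 ⊢
  rw [← hD3] at e3 ⊢
  field_simp
  rw [hD1, hD2, hD3]
  ring

/-- The values of `psi q a x` at `qz`, `z` and `z/q` are all rational multiples of `psi q a (q⁻¹ *
x) z`, so the claim reduces to `vCoef_psi_identity`. -/
theorem awOp_psi {q a b c d x z : ℂ} (hq0 : q ≠ 0) (hq : ‖q‖ < 1) (hx : x ≠ 0)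
    (hz : GenericPoint q a x z) :
    awOp q a b c d (psi q a x) z =
      -(1 - x⁻¹) * (1 - a * b * c * d * x * q⁻¹) * psi q a x z +
        lowerCoef q a b c d x * psi q a (q⁻¹ * x) z := by
  have hz0 := hz.1
  have n0 := hz.ne_one 0
  have nm := hz.ne_one (-1)
  have n1 : ∀ k : ℕ, _ := fun k => hz.ne_one (k + 1)
  simp only [zpow_zero, mul_one, zpow_neg_one] at n0 nm
  have h1 : 1 - a * z ≠ 0 := sub_ne_zero.2 n0.1.symm
  have h2 : 1 - a * z⁻¹ ≠ 0 := sub_ne_zero.2 n0.2.1.symm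
  have h3 : 1 - a * x * z ≠ 0 := sub_ne_zero.2 n0.2.2.1.symm
  have h4 : 1 - a * x * z⁻¹ ≠ 0 := sub_ne_zero.2 n0.2.2.2.symm
  have h5 : 1 - a * x * q⁻¹ * z ≠ 0 :=
    sub_ne_zero.2 (by rw [mul_right_comm]; exact nm.2.2.1.symm)
  have h6 : 1 - a * x * q⁻¹ * z⁻¹ ≠ 0 :=
    sub_ne_zero.2 (by rw [mul_right_comm]; exact nm.2.2.2.symm)
  have H1 : qPochInf (a * x * z * q) q ≠ 0 := qPochInf_ne_zero hq fun k => by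
    have := (n1 k).2.2.1
    rw [zpow_add_one₀ hq0, zpow_natCast] at this
    intro h; apply this; rw [← h]; ring
  have H2 : qPochInf (a * x * z⁻¹ * q) q ≠ 0 := qPochInf_ne_zero hq fun k => by
    have := (n1 k).2.2.2
    rw [zpow_add_one₀ hq0, zpow_natCast] at this
    intro h; apply this; rw [← h]; ring
  -- Peeling off two factors brings all the shifted denominators down to the same infinite products
  -- `(axzq; q)_∞` and `(axq/z; q)_∞`.
  have down : ∀ y w : ℂ, qPochInf (y * q⁻¹ * w) q =
      (1 - y * q⁻¹ * w) * ((1 - y * w) * qPochInf (y * w * q) q) := fun y w => by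
    rw [qPochInf_eq hq (y * q⁻¹ * w), mul_right_comm y, inv_mul_cancel_right₀ hq0,
      qPochInf_eq hq (y * w)]
  have e0 : psi q a x z = (1 - a * x * q⁻¹ * z) * (1 - a * x * q⁻¹ * z⁻¹) *
      psi q a (q⁻¹ * x) z := by
    unfold psi
    rw [show a * (q⁻¹ * x) = a * x * q⁻¹ by ring, down, down, qPochInf_eq hq (a * x * z),
      qPochInf_eq hq (a * x * z⁻¹)]
    generalize 1 - a * z = A1 at *
    generalize 1 - a * z⁻¹ = A2 at *
    generalize 1 - a * x * z = A3 at *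
    generalize 1 - a * x * z⁻¹ = A4 at *
    generalize 1 - a * x * q⁻¹ * z = A5 at *
    generalize 1 - a * x * q⁻¹ * z⁻¹ = A6 at *
    generalize qPochInf (a * x * z * q) q = H1' at *
    generalize qPochInf (a * x * z⁻¹ * q) q = H2' at *
    field_simp
  have e1 : psi q a x (q * z) = (1 - a * q⁻¹ * z⁻¹) * (1 - a * x * q⁻¹ * z) * (1 - a * x * z) /
      (1 - a * z) * psi q a (q⁻¹ * x) z := by
    unfold psi
    rw [show a * (q⁻¹ * x) = a * x * q⁻¹ by ring, mul_inv, ← mul_assoc a q⁻¹, ← mul_assoc _ q⁻¹,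
      down, down, down, qPochInf_eq hq (a * z), qPochInf_eq hq (a * z⁻¹),
      show a * (q * z) = a * z * q by ring, show a * x * (q * z) = a * x * z * q by ring]
    generalize 1 - a * z = A1 at *
    generalize 1 - a * z⁻¹ = A2 at *
    generalize 1 - a * x * z = A3 at *
    generalize 1 - a * x * z⁻¹ = A4 at *
    generalize 1 - a * x * q⁻¹ * z = A5 at *
    generalize 1 - a * x * q⁻¹ * z⁻¹ = A6 at *
    generalize qPochInf (a * x * z * q) q = H1' at *
    generalize qPochInf (a * x * z⁻¹ * q) q = H2' at *
    field_simp
  have e2 : psi q a x (q⁻¹ * z) = (1 - a * q⁻¹ * z) * (1 - a * x * q⁻¹ * z⁻¹) *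
      (1 - a * x * z⁻¹) / (1 - a * z⁻¹) * psi q a (q⁻¹ * x) z := by
    unfold psi
    rw [show a * (q⁻¹ * x) = a * x * q⁻¹ by ring, mul_inv, inv_inv, ← mul_assoc a q⁻¹,
      ← mul_assoc _ q⁻¹,
      down, down, down, qPochInf_eq hq (a * z), qPochInf_eq hq (a * z⁻¹),
      show a * (q * z⁻¹) = a * z⁻¹ * q by ring, show a * x * (q * z⁻¹) = a * x * z⁻¹ * q by ring]
    generalize 1 - a * z = A1 at *
    generalize 1 - a * z⁻¹ = A2 at *
    generalize 1 - a * x * z = A3 at *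
    generalize 1 - a * x * z⁻¹ = A4 at *
    generalize 1 - a * x * q⁻¹ * z = A5 at *
    generalize 1 - a * x * q⁻¹ * z⁻¹ = A6 at *
    generalize qPochInf (a * x * z * q) q = H1' at *
    generalize qPochInf (a * x * z⁻¹ * q) q = H2' at *
    field_simp
  have key := vCoef_psi_identity (b := b) (c := c) (d := d) hq0 hz.regular hx h1 h2
  unfold awOp
  rw [e0, e1, e2]
  linear_combination psi q a (q⁻¹ * x) z * key

theorem awOp_add (q a b c d : ℂ) (f g : ℂ → ℂ) (z : ℂ) :
    awOp q a b c d (fun w => f w + g w) z = awOp q a b c d f z + awOp q a b c d g z := by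
  unfold awOp; ring

theorem awOp_const_mul (q a b c d p : ℂ) (f : ℂ → ℂ) (z : ℂ) :
    awOp q a b c d (fun w => p * f w) z = p * awOp q a b c d f z := by
  unfold awOp; ring

theorem awOp_congr {q a b c d z : ℂ} {f g : ℂ → ℂ} (h1 : f (q * z) = g (q * z)) (h0 : f z = g z)
    (h2 : f (q⁻¹ * z) = g (q⁻¹ * z)) : awOp q a b c d f z = awOp q a b c d g z := by
  unfold awOp; rw [h1, h0, h2]

theorem tendsto_awOp {ι : Type*} {l : Filter ι} {q a b c d z : ℂ} {F : ι → ℂ → ℂ} {f : ℂ → ℂ}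
    (h1 : Tendsto (fun i => F i (q * z)) l (𝓝 (f (q * z))))
    (h0 : Tendsto (fun i => F i z) l (𝓝 (f z)))
    (h2 : Tendsto (fun i => F i (q⁻¹ * z)) l (𝓝 (f (q⁻¹ * z)))) :
    Tendsto (fun i => awOp q a b c d (F i) z) l (𝓝 (awOp q a b c d f z)) :=
  ((h1.const_mul _).sub (h0.const_mul _)).add (h2.const_mul _)

/-! ### The series `u`, its inhomogeneous equation, and the eigenfunction `y` -/

/-- The product `(abα, acα, adα, αq; q)_i` of the denominators in `uFun`. -/
def uDenom (q a b c d α : ℂ) (i : ℕ) : ℂ :=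
  qPoch (a * b * α) q i * qPoch (a * c * α) q i * qPoch (a * d * α) q i * qPoch (α * q) q i

/-- The product `(abα, acα, adα, αq; q)_∞`. -/
def uDenomInf (q a b c d α : ℂ) : ℂ :=
  qPochInf (a * b * α) q * qPochInf (a * c * α) q * qPochInf (a * d * α) q * qPochInf (α * q) q

/-- The coefficient of `psi q a (α q^i)` in `uFun`. -/
def uCoef (q a b c d α t : ℂ) (i : ℕ) : ℂ :=
  qPoch (α * t) q i * qPoch (a * b * c * d * α * t⁻¹ * q⁻¹) q i / uDenom q a b c d α i * q ^ i

/-- The denominators `(abα, acα, adα, αq; q)_i` do not vanish. -/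
def NonvanishingDenom (q a b c d α : ℂ) : Prop :=
  ∀ k : ℕ, a * b * α * q ^ k ≠ 1 ∧ a * c * α * q ^ k ≠ 1 ∧ a * d * α * q ^ k ≠ 1 ∧
    α * q * q ^ k ≠ 1

section

variable {q a b c d α t z : ℂ}

theorem NonvanishingDenom.uDenom_ne_zero (h : NonvanishingDenom q a b c d α) (i : ℕ) :
    uDenom q a b c d α i ≠ 0 :=
  mul_ne_zero (mul_ne_zero (mul_ne_zero (qPoch_ne_zero (fun k => (h k).1) i)
    (qPoch_ne_zero (fun k => (h k).2.1) i)) (qPoch_ne_zero (fun k => (h k).2.2.1) i))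
    (qPoch_ne_zero (fun k => (h k).2.2.2) i)

theorem NonvanishingDenom.uDenomInf_ne_zero (hq : ‖q‖ < 1) (h : NonvanishingDenom q a b c d α) :
    uDenomInf q a b c d α ≠ 0 :=
  mul_ne_zero (mul_ne_zero (mul_ne_zero (qPochInf_ne_zero hq fun k => (h k).1)
    (qPochInf_ne_zero hq fun k => (h k).2.1)) (qPochInf_ne_zero hq fun k => (h k).2.2.1))
    (qPochInf_ne_zero hq fun k => (h k).2.2.2)

theorem tendsto_uDenom (hq : ‖q‖ < 1) :
    Tendsto (uDenom q a b c d α) atTop (𝓝 (uDenomInf q a b c d α)) :=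
  (((tendsto_qPoch hq _).mul (tendsto_qPoch hq _)).mul (tendsto_qPoch hq _)).mul
    (tendsto_qPoch hq _)

theorem psi_mul_pow (hq : ‖q‖ < 1) (hz : GenericPoint q a α z) (i : ℕ) :
    psi q a (α * q ^ i) z =
      psi q a α z * (qPoch (a * α * z) q i * qPoch (a * α * z⁻¹) q i) := by
  have n1 : qPoch (a * α * z) q i ≠ 0 :=
    qPoch_ne_zero (fun k => by simpa using (hz.ne_one k).2.2.1) i
  have n2 : qPoch (a * α * z⁻¹) q i ≠ 0 :=
    qPoch_ne_zero (fun k => by simpa using (hz.ne_one k).2.2.2) i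
  unfold psi
  rw [← qPoch_mul_qPochInf hq (a * α * z) i, ← qPoch_mul_qPochInf hq (a * α * z⁻¹) i,
    show a * (α * q ^ i) * z = a * α * z * q ^ i by ring,
    show a * (α * q ^ i) * z⁻¹ = a * α * z⁻¹ * q ^ i by ring]
  generalize qPoch (a * α * z) q i = X at *
  generalize qPoch (a * α * z⁻¹) q i = Y at *
  field_simp

/-- The limit no longer involves `α`. This is why the boundary terms at infinity of two different
series are proportional as functions of `z`. -/
theorem tendsto_psi_mul_pow (hq : ‖q‖ < 1) (hz : GenericPoint q a α z) :
    Tendsto (fun i : ℕ => psi q a (α * q ^ i) z) atTop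
      (𝓝 (qPochInf (a * z) q * qPochInf (a * z⁻¹) q)) := by
  have n1 : qPochInf (a * α * z) q ≠ 0 :=
    qPochInf_ne_zero hq fun k => by simpa using (hz.ne_one k).2.2.1
  have n2 : qPochInf (a * α * z⁻¹) q ≠ 0 :=
    qPochInf_ne_zero hq fun k => by simpa using (hz.ne_one k).2.2.2
  have h := (((tendsto_qPoch hq (a * α * z)).mul (tendsto_qPoch hq (a * α * z⁻¹))).const_mul
    (psi q a α z)).congr fun i => (psi_mul_pow hq hz i).symm
  convert h using 2
  unfold psi
  generalize qPochInf (a * α * z) q = X at *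
  generalize qPochInf (a * α * z⁻¹) q = Y at *
  field_simp

theorem uFun_eq_tsum (hq : ‖q‖ < 1) (hz : GenericPoint q a α z) :
    uFun q a b c d α t z = ∑' i : ℕ, uCoef q a b c d α t i * psi q a (α * q ^ i) z := by
  unfold uFun
  rw [← tsum_mul_left]
  refine tsum_congr fun i => ?_
  rw [psi_mul_pow hq hz]
  unfold uCoef uDenom psi
  ring

/-- `M` depends on `R` but not on `t`, so one estimate gives both summability and the domination
needed for `t → 1`. -/
theorem exists_uCoef_bound (hq : ‖q‖ < 1) (hd : NonvanishingDenom q a b c d α)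
    (hz : GenericPoint q a α z) (R : ℝ) :
    ∃ M : ℝ, ∀ t : ℂ, ‖α * t‖ ≤ R → ‖a * b * c * d * α * t⁻¹ * q⁻¹‖ ≤ R → ∀ i : ℕ,
      ‖uCoef q a b c d α t i * psi q a (α * q ^ i) z‖ ≤ M * ‖q‖ ^ i := by
  have hq' : 0 ≤ (1 - ‖q‖)⁻¹ := inv_nonneg.2 (by linarith)
  -- The part of the term free of `t` and `q ^ i` converges as `i → ∞`, hence is bounded.
  obtain ⟨B, hB⟩ := ((tendsto_psi_mul_pow hq hz).div (tendsto_uDenom hq)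
    (hd.uDenomInf_ne_zero hq)).norm.bddAbove_range
  refine ⟨Real.exp (R * (1 - ‖q‖)⁻¹) * Real.exp (R * (1 - ‖q‖)⁻¹) * B, fun t h1 h2 i => ?_⟩
  have e : uCoef q a b c d α t i * psi q a (α * q ^ i) z =
      qPoch (α * t) q i * qPoch (a * b * c * d * α * t⁻¹ * q⁻¹) q i *
        (psi q a (α * q ^ i) z / uDenom q a b c d α i) * q ^ i := by
    unfold uCoef; ring
  rw [e, norm_mul, norm_mul, norm_mul, norm_pow]
  have b1 := (norm_qPoch_le hq (α * t) i).trans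
    (Real.exp_le_exp.2 (mul_le_mul_of_nonneg_right h1 hq'))
  have b2 := (norm_qPoch_le hq (a * b * c * d * α * t⁻¹ * q⁻¹) i).trans
    (Real.exp_le_exp.2 (mul_le_mul_of_nonneg_right h2 hq'))
  have b3 : ‖psi q a (α * q ^ i) z / uDenom q a b c d α i‖ ≤ B := hB ⟨i, rfl⟩
  gcongr

theorem summable_uCoef (hq : ‖q‖ < 1) (hd : NonvanishingDenom q a b c d α)
    (hz : GenericPoint q a α z) :
    Summable fun i : ℕ => uCoef q a b c d α t i * psi q a (α * q ^ i) z := by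
  obtain ⟨M, hM⟩ := exists_uCoef_bound hq hd hz
    (max ‖α * t‖ ‖a * b * c * d * α * t⁻¹ * q⁻¹‖)
  exact Summable.of_norm_bounded
    ((summable_geometric_of_lt_one (norm_nonneg _) hq).mul_left M)
    (hM t (le_max_left _ _) (le_max_right _ _))

/-- For `x = α q^i`, the two factors involving `t` are those that extend `(αt; q)_i` and
`(abcdα/(tq); q)_i` to index `i + 1`. -/
theorem eigval_sub (hq0 : q ≠ 0) {x : ℂ} (hx : x ≠ 0) (ht : t ≠ 0) :
    -(1 - x⁻¹) * (1 - a * b * c * d * x * q⁻¹) - eigval q a b c d t 0 =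
      x⁻¹ * (1 - x * t) * (1 - a * b * c * d * x * t⁻¹ * q⁻¹) := by
  unfold eigval
  simp only [neg_zero, zpow_zero, zero_sub, zpow_neg_one]
  field_simp
  ring

/-- The recurrence that cancels the coefficient of `psi q a (α * q ^ i)` in `(L - ᵗλ(0)) u`. -/
theorem uCoef_succ_mul_lowerCoef (hq0 : q ≠ 0) (hd : NonvanishingDenom q a b c d α) (hα : α ≠ 0)
    (ht : t ≠ 0) (i : ℕ) :
    uCoef q a b c d α t (i + 1) * lowerCoef q a b c d (α * q ^ (i + 1)) =
      -(uCoef q a b c d α t i * (-(1 - (α * q ^ i)⁻¹) *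
        (1 - a * b * c * d * (α * q ^ i) * q⁻¹) - eigval q a b c d t 0)) := by
  have hqi : q ^ i ≠ 0 := pow_ne_zero _ hq0
  rw [eigval_sub hq0 (mul_ne_zero hα hqi) ht]
  have hD := hd.uDenom_ne_zero i
  have h1 : 1 - a * b * α * q ^ i ≠ 0 := sub_ne_zero.2 (hd i).1.symm
  have h2 : 1 - a * c * α * q ^ i ≠ 0 := sub_ne_zero.2 (hd i).2.1.symm
  have h3 : 1 - a * d * α * q ^ i ≠ 0 := sub_ne_zero.2 (hd i).2.2.1.symm
  have h4 : 1 - α * q * q ^ i ≠ 0 := sub_ne_zero.2 (hd i).2.2.2.symm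
  have eD : uDenom q a b c d α (i + 1) = uDenom q a b c d α i * ((1 - a * b * α * q ^ i) *
      (1 - a * c * α * q ^ i) * (1 - a * d * α * q ^ i) * (1 - α * q * q ^ i)) := by
    unfold uDenom; simp only [qPoch_succ]; ring
  have eL : lowerCoef q a b c d (α * q ^ (i + 1)) = -(α * q * q ^ i)⁻¹ * ((1 - a * b * α * q ^ i) *
      (1 - a * c * α * q ^ i) * (1 - a * d * α * q ^ i) * (1 - α * q * q ^ i)) := by
    have e : ∀ y : ℂ, 1 - y * (α * q ^ (i + 1)) * q⁻¹ = 1 - y * α * q ^ i := fun y => by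
      rw [pow_succ]; field_simp
    unfold lowerCoef
    rw [e, e, e, pow_succ]
    field_simp
    ring
  unfold uCoef
  rw [eD, eL, qPoch_succ, qPoch_succ, pow_succ,
    show a * b * c * d * (α * q ^ i) * t⁻¹ * q⁻¹ =
      a * b * c * d * α * t⁻¹ * q⁻¹ * q ^ i by ring]
  generalize qPoch (α * t) q i = X at *
  generalize qPoch _ q i = Y at *
  generalize uDenom q a b c d α i = D at *
  generalize 1 - a * b * c * d * α * t⁻¹ * q⁻¹ * q ^ i = W at *
  generalize 1 - a * b * α * q ^ i = A1 at *
  generalize 1 - a * c * α * q ^ i = A2 at *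
  generalize 1 - a * d * α * q ^ i = A3 at *
  generalize 1 - α * q * q ^ i = A4 at *
  field_simp

/-- Telescoping by the recurrence leaves only the top term, of index `N`, and the bottom term at
`α/q`. -/
theorem awOp_sum_psi (hq0 : q ≠ 0) (hq : ‖q‖ < 1) (hd : NonvanishingDenom q a b c d α)
    (hα : α ≠ 0) (ht : t ≠ 0) (hz : GenericPoint q a α z) (N : ℕ) :
    awOp q a b c d (fun w => ∑ i ∈ Finset.range (N + 1),
        uCoef q a b c d α t i * psi q a (α * q ^ i) w) z =
      eigval q a b c d t 0 * ∑ i ∈ Finset.range (N + 1),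
        uCoef q a b c d α t i * psi q a (α * q ^ i) z +
      uCoef q a b c d α t N * (-(1 - (α * q ^ N)⁻¹) * (1 - a * b * c * d * (α * q ^ N) * q⁻¹) -
        eigval q a b c d t 0) * psi q a (α * q ^ N) z +
      lowerCoef q a b c d α * psi q a (q⁻¹ * α) z := by
  induction N with
  | zero =>
    have h := awOp_psi (b := b) (c := c) (d := d) hq0 hq hα hz
    simp only [zero_add, Finset.sum_range_one, awOp_const_mul, pow_zero, mul_one, h]
    simp only [uCoef, uDenom, qPoch_zero, pow_zero]
    ring
  | succ N ih =>
    have hqN : q ^ (N + 1) ≠ 0 := pow_ne_zero _ hq0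
    have hz' : GenericPoint q a (α * q ^ (N + 1)) z := by
      simpa only [zpow_natCast] using hz.mul_zpow hq0 ((N + 1 : ℕ) : ℤ)
    have h := awOp_psi (b := b) (c := c) (d := d) hq0 hq (mul_ne_zero hα hqN) hz'
    rw [show q⁻¹ * (α * q ^ (N + 1)) = α * q ^ N by rw [pow_succ]; field_simp] at h
    simp only [Finset.sum_range_succ _ (N + 1), awOp_add, awOp_const_mul, ih, h]
    linear_combination psi q a (α * q ^ N) z * uCoef_succ_mul_lowerCoef (b := b) (c := c) (d := d)
      hq0 hd hα ht N

theorem tendsto_uCoef_mul (hq0 : q ≠ 0) (hq : ‖q‖ < 1) (hd : NonvanishingDenom q a b c d α)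
    (hα : α ≠ 0) (ht : t ≠ 0) :
    Tendsto (fun N : ℕ => uCoef q a b c d α t N * (-(1 - (α * q ^ N)⁻¹) *
      (1 - a * b * c * d * (α * q ^ N) * q⁻¹) - eigval q a b c d t 0)) atTop
      (𝓝 (α⁻¹ * (qPochInf (α * t) q * qPochInf (a * b * c * d * α * t⁻¹ * q⁻¹) q /
        uDenomInf q a b c d α))) := by
  -- The factor from `eigval_sub` lengthens both numerators to `N + 1`, while its `(α q^N)⁻¹`
  -- cancels the `q ^ N` in `uCoef`.
  have h1 := (tendsto_add_atTop_iff_nat 1).2 (tendsto_qPoch hq (α * t))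
  have h2 := (tendsto_add_atTop_iff_nat 1).2
    (tendsto_qPoch hq (a * b * c * d * α * t⁻¹ * q⁻¹))
  refine (((h1.mul h2).div (tendsto_uDenom hq) (hd.uDenomInf_ne_zero hq)).const_mul α⁻¹).congr
    fun N => ?_
  change α⁻¹ * (qPoch (α * t) q (N + 1) *
    qPoch (a * b * c * d * α * t⁻¹ * q⁻¹) q (N + 1) / uDenom q a b c d α N) = _
  have hqN : q ^ N ≠ 0 := pow_ne_zero _ hq0
  have hD := hd.uDenom_ne_zero N
  rw [eigval_sub hq0 (mul_ne_zero hα hqN) ht,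
    show a * b * c * d * (α * q ^ N) * t⁻¹ * q⁻¹ =
      a * b * c * d * α * t⁻¹ * q⁻¹ * q ^ N by ring, qPoch_succ, qPoch_succ, uCoef]
  generalize 1 - a * b * c * d * α * t⁻¹ * q⁻¹ * q ^ N = W
  generalize qPoch (a * b * c * d * α * t⁻¹ * q⁻¹) q N = X
  generalize qPoch (α * t) q N = Y
  generalize uDenom q a b c d α N = D at *
  field_simp

theorem awOp_uFun (hq0 : q ≠ 0) (hq : ‖q‖ < 1) (hd : NonvanishingDenom q a b c d α)
    (hα : α ≠ 0) (ht : t ≠ 0) (hz : GenericPoint q a α z) :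
    awOp q a b c d (uFun q a b c d α t) z =
      eigval q a b c d t 0 * uFun q a b c d α t z +
      α⁻¹ * (qPochInf (α * t) q * qPochInf (a * b * c * d * α * t⁻¹ * q⁻¹) q /
        uDenomInf q a b c d α) * (qPochInf (a * z) q * qPochInf (a * z⁻¹) q) +
      lowerCoef q a b c d α * psi q a (q⁻¹ * α) z := by
  have hS : ∀ w, GenericPoint q a α w → Tendsto (fun N : ℕ => ∑ i ∈ Finset.range (N + 1),
      uCoef q a b c d α t i * psi q a (α * q ^ i) w) atTop (𝓝 (uFun q a b c d α t w)) :=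
    fun w hw => by
      rw [uFun_eq_tsum hq hw]
      exact (tendsto_add_atTop_iff_nat 1).2
        (summable_uCoef hq hd hw).hasSum.tendsto_sum_nat
  have hL := tendsto_awOp (a := a) (b := b) (c := c) (d := d) (z := z)
    (F := fun (N : ℕ) w => ∑ i ∈ Finset.range (N + 1),
      uCoef q a b c d α t i * psi q a (α * q ^ i) w) (f := uFun q a b c d α t) (hS _ (hz.mul_left hq0)) (hS _ hz)
    (hS _ (hz.inv_mul_left hq0))
  have hB := tendsto_uCoef_mul (b := b) (c := c) (d := d) hq0 hq hd hα ht
  have hR := (((hS z hz).const_mul (eigval q a b c d t 0)).add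
    (hB.mul (tendsto_psi_mul_pow hq hz))).add_const
      (lowerCoef q a b c d α * psi q a (q⁻¹ * α) z)
  exact tendsto_nhds_unique
    (hL.congr fun N => awOp_sum_psi (b := b) (c := c) (d := d) hq0 hq hd hα ht hz N) hR

theorem nonvanishingDenom_one (hq : ‖q‖ < 1) (hab : ∀ k : ℕ, a * b * q ^ k ≠ 1)
    (hac : ∀ k : ℕ, a * c * q ^ k ≠ 1) (had : ∀ k : ℕ, a * d * q ^ k ≠ 1) :
    NonvanishingDenom q a b c d 1 := fun k => by
  refine ⟨by simpa using hab k, by simpa using hac k, by simpa using had k, fun h => ?_⟩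
  rw [one_mul, ← pow_succ'] at h
  exact pow_ne_one_of_norm_lt_one hq (Nat.succ_ne_zero k) h

theorem AdmissibleAlpha.nonvanishingDenom (h : AdmissibleAlpha q a b c d α) :
    NonvanishingDenom q a b c d α := fun k =>
  ⟨(h.2 k).1, (h.2 k).2.1, (h.2 k).2.2.1, by
    rw [mul_assoc, ← pow_succ']; exact (h.2 (k + 1)).2.2.2⟩

theorem AdmissibleAlpha.ne_zero (hq0 : q ≠ 0) (h : AdmissibleAlpha q a b c d α) : α ≠ 0 := by
  rintro rfl
  rcases h.1 with h | h | h <;> exact hq0 (by simpa using h.symm)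

/-- The three choices of `α` are exactly what removes the lower boundary term: each kills one factor
of `lowerCoef`. -/
theorem AdmissibleAlpha.lowerCoef_eq_zero (hq0 : q ≠ 0) (h : AdmissibleAlpha q a b c d α) :
    lowerCoef q a b c d α = 0 := by
  unfold lowerCoef
  rcases h.1 with h | h | h <;> simp [h, hq0]

theorem GenericPoint.one (h : GenericPoint q a α z) : GenericPoint q a 1 z :=
  ⟨h.1, fun k => ⟨(h.2 k).1, (h.2 k).2.1, (h.2 k).2.2.1, by simpa using (h.2 k).2.1,
    by simpa using (h.2 k).2.2.1⟩⟩

theorem awOp_yFun (hq0 : q ≠ 0) (hq : ‖q‖ < 1) (hab : ∀ k : ℕ, a * b * q ^ k ≠ 1)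
    (hac : ∀ k : ℕ, a * c * q ^ k ≠ 1) (had : ∀ k : ℕ, a * d * q ^ k ≠ 1)
    (hα : AdmissibleAlpha q a b c d α) (ht : t ≠ 0)
    (ht' : ∀ k : ℕ, α * t * q ^ k ≠ 1 ∧ a * b * c * d * α * t⁻¹ * q⁻¹ * q ^ k ≠ 1)
    (hz : GenericPoint q a α z) :
    awOp q a b c d (yFun q a b c d α t) z =
      eigval q a b c d t 0 * yFun q a b c d α t z := by
  have hα0 := hα.ne_zero hq0
  have h1 := nonvanishingDenom_one hq hab hac had
  have U1 := awOp_uFun hq0 hq h1 one_ne_zero ht hz.one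
  have U2 := awOp_uFun hq0 hq hα.nonvanishingDenom hα0 ht hz
  rw [hα.lowerCoef_eq_zero hq0] at U2
  have l1 : lowerCoef q a b c d 1 = 0 := by simp [lowerCoef]
  rw [l1] at U1
  have D1 := h1.uDenomInf_ne_zero hq
  have D2 := hα.nonvanishingDenom.uDenomInf_ne_zero hq
  have n1 : qPochInf (α * t) q ≠ 0 := qPochInf_ne_zero hq fun k => (ht' k).1
  have n2 : qPochInf (a * b * c * d * α * t⁻¹ * q⁻¹) q ≠ 0 :=
    qPochInf_ne_zero hq fun k => (ht' k).2
  set K := qPochInf t q * qPochInf (a * b * c * d * t⁻¹ * q⁻¹) q * qPochInf (a * b * α) q *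
          qPochInf (a * c * α) q * qPochInf (a * d * α) q * qPochInf (α * q) q /
        (qPochInf (a * b) q * qPochInf (a * c) q * qPochInf (a * d) q * qPochInf q q *
          qPochInf (α * t) q * qPochInf (a * b * c * d * α * t⁻¹ * q⁻¹) q) with hK
  -- The coefficient of `u(z, t, α)` in `y` is the ratio of the two boundary constants at infinity.
  have hK' : α * K * (α⁻¹ * (qPochInf (α * t) q * qPochInf (a * b * c * d * α * t⁻¹ * q⁻¹) q /
      uDenomInf q a b c d α)) =
      1⁻¹ * (qPochInf (1 * t) q * qPochInf (a * b * c * d * 1 * t⁻¹ * q⁻¹) q /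
        uDenomInf q a b c d 1) := by
    have e1 : K = qPochInf t q * qPochInf (a * b * c * d * t⁻¹ * q⁻¹) q *
        uDenomInf q a b c d α / (uDenomInf q a b c d 1 *
          (qPochInf (α * t) q * qPochInf (a * b * c * d * α * t⁻¹ * q⁻¹) q)) := by
      rw [hK]; unfold uDenomInf; simp only [mul_one, one_mul]; congr 1 <;> ring
    rw [e1]
    simp only [mul_one, one_mul, inv_one]
    generalize qPochInf (a * b * c * d * α * t⁻¹ * q⁻¹) q = X at *
    generalize qPochInf (a * b * c * d * t⁻¹ * q⁻¹) q = Y at *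
    field_simp
  have e : yFun q a b c d α t = fun w =>
      uFun q a b c d 1 t w + -(α * K) * uFun q a b c d α t w := by
    funext w; unfold yFun; ring
  rw [e, awOp_add, awOp_const_mul, U1, U2]
  linear_combination -(qPochInf (a * z) q * qPochInf (a * z⁻¹) q) * hK'

/-- The functions `Phi` are eigenfunctions of the Askey-Wilson operator. -/
theorem awOp_Phi (hq0 : q ≠ 0) (hq : ‖q‖ < 1) (hab : ∀ k : ℕ, a * b * q ^ k ≠ 1)
    (hac : ∀ k : ℕ, a * c * q ^ k ≠ 1) (had : ∀ k : ℕ, a * d * q ^ k ≠ 1)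
    (hα : AdmissibleAlpha q a b c d α) (n : ℕ) (ht : AdmissibleT q a b c d α n t)
    (hz : GenericPoint q a α z) :
    awOp q a b c d (Phi q a b c d α t n) z =
      eigval q a b c d t n * Phi q a b c d α t n z := by
  induction n generalizing z with
  | zero => exact awOp_yFun hq0 hq hab hac had hα ht.1 ht.2.1 hz
  | succ n ih =>
    have ht' : AdmissibleT q a b c d α n t :=
      ⟨ht.1, ht.2.1, fun i hi => ht.2.2 i (hi.trans (Nat.lt_succ_self n))⟩
    have h1 := one_sub_ne_zero_of_norm_lt_one hq
    have h2 := one_add_ne_zero_of_norm_lt_one hq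
    have hn := ht.2.2 n (Nat.lt_succ_self n)
    have := awOp_raiseOp hq0 h1 h2 ht.1 (n := n) (by exact_mod_cast hn) hz.regular
      (ih ht' hz) (ih ht' (hz.mul_left hq0))
    simpa [Phi] using this

end

/-! ### The limit `t → 1` -/

section

variable {q a b c d α z : ℂ}

theorem tendsto_uFun (hq : ‖q‖ < 1) (hd : NonvanishingDenom q a b c d α)
    (hz : GenericPoint q a α z) :
    Tendsto (fun t => uFun q a b c d α t z) (𝓝 1) (𝓝 (uFun q a b c d α 1 z)) := by
  simp only [uFun_eq_tsum hq hz]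
  have c1 : ContinuousAt (fun t : ℂ => α * t) 1 := by fun_prop
  have c2 : ContinuousAt (fun t : ℂ => a * b * c * d * α * t⁻¹ * q⁻¹) 1 := by
    fun_prop (disch := exact one_ne_zero)
  -- The extra `1` makes the bounds strict at `t = 1`, so they persist on a neighbourhood.
  set R := max ‖α * 1‖ ‖a * b * c * d * α * 1⁻¹ * q⁻¹‖ + 1 with hR
  obtain ⟨M, hM⟩ := exists_uCoef_bound hq hd hz R
  refine tendsto_tsum_of_dominated_convergence
    ((summable_geometric_of_lt_one (norm_nonneg _) hq).mul_left M) (fun i => ?_) ?_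
  · refine Tendsto.mul_const _ (Tendsto.mul_const _ (Tendsto.div_const ?_ _))
    exact (((continuous_qPoch q i).continuousAt.tendsto).comp c1.tendsto).mul
      (((continuous_qPoch q i).continuousAt.tendsto).comp c2.tendsto)
  · filter_upwards [c1.norm.eventually_lt_const
        ((le_max_left _ _).trans_lt (lt_add_one _) : ‖α * 1‖ < R),
      c2.norm.eventually_lt_const ((le_max_right _ _).trans_lt (lt_add_one _) :
        ‖a * b * c * d * α * 1⁻¹ * q⁻¹‖ < R)] with t h1 h2
    exact hM t h1.le h2.le

theorem uFun_one_one (hq : ‖q‖ < 1) (hz : GenericPoint q a 1 z) : uFun q a b c d 1 1 z = 1 := by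
  rw [uFun_eq_tsum hq hz, tsum_eq_single 0]
  · have n1 : qPochInf (a * z) q ≠ 0 :=
      qPochInf_ne_zero hq fun k => by simpa using (hz.ne_one k).1
    have n2 : qPochInf (a * z⁻¹) q ≠ 0 :=
      qPochInf_ne_zero hq fun k => by simpa using (hz.ne_one k).2.1
    simp [uCoef, uDenom, qPoch_zero, psi, n1, n2]
  · intro i hi
    rw [uCoef, qPoch_eq_zero (j := 0) (by simp) (Nat.pos_of_ne_zero hi)]
    simp

/-- The coefficient of `u(z, t, α)` contains `(t; q)_∞`, which vanishes at `t = 1`, while the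
condition on `abcdα` keeps its denominator nonzero there. Only `u(z, 1, 1) = 1` survives. -/
theorem tendsto_yFun (hq : ‖q‖ < 1) (hab : ∀ k : ℕ, a * b * q ^ k ≠ 1)
    (hac : ∀ k : ℕ, a * c * q ^ k ≠ 1) (had : ∀ k : ℕ, a * d * q ^ k ≠ 1)
    (hα : AdmissibleAlpha q a b c d α) (hα' : ∀ k : ℕ, a * b * c * d * α * q⁻¹ * q ^ k ≠ 1)
    (hz : GenericPoint q a α z) :
    Tendsto (fun t => yFun q a b c d α t z) (𝓝 1) (𝓝 1) := by
  have h1 := nonvanishingDenom_one hq hab hac had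
  have hu1 := tendsto_uFun hq h1 hz.one
  rw [uFun_one_one hq hz.one] at hu1
  have hu2 := tendsto_uFun hq hα.nonvanishingDenom hz
  have hc := continuous_qPochInf hq
  have n1 : qPochInf (a * b) q * qPochInf (a * c) q * qPochInf (a * d) q * qPochInf q q *
      qPochInf (α * 1) q * qPochInf (a * b * c * d * α * 1⁻¹ * q⁻¹) q ≠ 0 := by
    refine mul_ne_zero (mul_ne_zero (by simpa [uDenomInf] using h1.uDenomInf_ne_zero hq)
      (qPochInf_ne_zero hq fun k => ?_)) (qPochInf_ne_zero hq fun k => ?_)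
    · simpa using (hα.2 k).2.2.2
    · simpa using hα' k
  have hK : ContinuousAt (fun t : ℂ => qPochInf t q * qPochInf (a * b * c * d * t⁻¹ * q⁻¹) q *
      qPochInf (a * b * α) q * qPochInf (a * c * α) q * qPochInf (a * d * α) q *
      qPochInf (α * q) q /
        (qPochInf (a * b) q * qPochInf (a * c) q * qPochInf (a * d) q * qPochInf q q *
          qPochInf (α * t) q * qPochInf (a * b * c * d * α * t⁻¹ * q⁻¹) q)) 1 := by
    have ci : ContinuousAt (fun t : ℂ => t⁻¹) 1 := continuousAt_inv₀ one_ne_zero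
    have c1 : ContinuousAt (fun t : ℂ => qPochInf (a * b * c * d * t⁻¹ * q⁻¹) q) 1 :=
      hc.continuousAt.comp (f := fun t : ℂ => a * b * c * d * t⁻¹ * q⁻¹) (by fun_prop)
    have c2 : ContinuousAt (fun t : ℂ => qPochInf (a * b * c * d * α * t⁻¹ * q⁻¹) q) 1 :=
      hc.continuousAt.comp (f := fun t : ℂ => a * b * c * d * α * t⁻¹ * q⁻¹) (by fun_prop)
    have c3 : ContinuousAt (fun t : ℂ => qPochInf (α * t) q) 1 :=
      hc.continuousAt.comp (f := fun t : ℂ => α * t) (by fun_prop)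
    have c4 : ContinuousAt (fun t : ℂ => qPochInf t q) 1 := hc.continuousAt
    exact ContinuousAt.div (by fun_prop) (by fun_prop) n1
  have hK0 := hK.tendsto
  rw [qPochInf_eq_zero hq (σ := 1) (j := 0) (by simp)] at hK0
  have := hu1.sub ((hK0.const_mul α).mul hu2)
  simpa [yFun] using this

theorem continuousAt_eigval (n : ℤ) :
    ContinuousAt (fun t => eigval q a b c d t n) 1 := by
  unfold eigval
  have ci : ContinuousAt (fun t : ℂ => t⁻¹) 1 := continuousAt_inv₀ one_ne_zero
  fun_prop

theorem eigval_sub_succ_ne_zero (hq0 : q ≠ 0) (h1 : 1 - q ≠ 0) {t : ℂ} {n : ℤ} (ht : t ≠ 0)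
    (hn : t ^ 2 ≠ a * b * c * d * q ^ (2 * n)) :
    eigval q a b c d t n - eigval q a b c d t (n + 1) ≠ 0 := by
  obtain ⟨s, r, hs, hs0, hr, hsr, h4⟩ := exists_spectral_param hq0 ht hn
  rw [eigval_eq hq0 hs hs0 hr, eigval_succ hq0 hs hs0 hr]
  have : -(1 - s) * (1 - r / q) - -(1 - s / q) * (1 - r) = -(1 - q) * (s - r) / q := by
    field_simp; ring
  rw [this]
  exact div_ne_zero (mul_ne_zero (neg_ne_zero.2 h1) hsr) hq0

theorem continuousAt_funF (hq0 : q ≠ 0) (h1 : 1 - q ≠ 0) {n : ℤ}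
    (hn : 1 ≠ a * b * c * d * q ^ (2 * n)) :
    ContinuousAt (fun t => funF q a b c d t n z) 1 := by
  have e0 := continuousAt_eigval (q := q) (a := a) (b := b) (c := c) (d := d) n
  have e1 := continuousAt_eigval (q := q) (a := a) (b := b) (c := c) (d := d) (n + 1)
  have hne := eigval_sub_succ_ne_zero hq0 h1 one_ne_zero (by rwa [one_pow])
  -- `β₀` is the only coefficient with an eigenvalue difference in its denominator.
  have hB : ContinuousAt (fun t => coefBeta0 q a b c d t n) 1 := by
    unfold coefBeta0
    refine ContinuousAt.mul (ContinuousAt.div (by fun_prop) (by fun_prop)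
      (mul_ne_zero hne (pow_ne_zero _ hq0))) (by fun_prop)
  unfold funF coefFm2 coefFm1 coefF0 coefF1 coefF2
  fun_prop

/-- The raising operators at `t = 1` with indices `0, …, n - 1` applied to the constant `1`. -/
def limPhi (q a b c d : ℂ) : ℕ → ℂ → ℂ
  | 0 => fun _ => 1
  | n + 1 => raiseOp q a b c d 1 (n : ℤ) (limPhi q a b c d n)

theorem one_ne_abcd_mul_zpow (hq0 : q ≠ 0) (h : ∀ k : ℕ, a * b * c * d * q⁻¹ * q ^ k ≠ 1)
    (n : ℕ) : 1 ≠ a * b * c * d * q ^ (2 * (n : ℤ)) := by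
  intro h1
  -- The odd index absorbs the extra `q⁻¹` in the hypothesis.
  apply h (2 * n + 1)
  rw [h1, pow_succ]
  field_simp
  norm_cast

theorem tendsto_Phi (hq0 : q ≠ 0) (hq : ‖q‖ < 1) (hab : ∀ k : ℕ, a * b * q ^ k ≠ 1)
    (hac : ∀ k : ℕ, a * c * q ^ k ≠ 1) (had : ∀ k : ℕ, a * d * q ^ k ≠ 1)
    (habcd : ∀ k : ℕ, a * b * c * d * q⁻¹ * q ^ k ≠ 1)
    (hα : AdmissibleAlpha q a b c d α) (hα' : ∀ k : ℕ, a * b * c * d * α * q⁻¹ * q ^ k ≠ 1)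
    (n : ℕ) (hz : GenericPoint q a α z) :
    Tendsto (fun t => Phi q a b c d α t n z) (𝓝 1) (𝓝 (limPhi q a b c d n z)) := by
  induction n generalizing z with
  | zero => exact tendsto_yFun hq hab hac had hα hα' hz
  | succ n ih =>
    exact ((ih (hz.mul_left hq0)).const_mul _).add
      ((continuousAt_funF hq0 (one_sub_ne_zero_of_norm_lt_one hq)
        (one_ne_abcd_mul_zpow hq0 habcd n)).tendsto.mul (ih hz))

/-- The infinitely many conditions over `k` follow from the nonvanishing of two infinite products
continuous at `t = 1`, which is an open condition. -/
theorem eventually_admissibleT (hq0 : q ≠ 0) (hq : ‖q‖ < 1)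
    (habcd : ∀ k : ℕ, a * b * c * d * q⁻¹ * q ^ k ≠ 1)
    (hα : AdmissibleAlpha q a b c d α) (hα' : ∀ k : ℕ, a * b * c * d * α * q⁻¹ * q ^ k ≠ 1)
    (n : ℕ) : ∀ᶠ t in 𝓝 (1 : ℂ), AdmissibleT q a b c d α n t := by
  have hc := continuous_qPochInf hq
  have ci : ContinuousAt (fun t : ℂ => t⁻¹) 1 := continuousAt_inv₀ one_ne_zero
  have c2 : ContinuousAt (fun t : ℂ => qPochInf (a * b * c * d * α * t⁻¹ * q⁻¹) q) 1 :=
    hc.continuousAt.comp (f := fun t : ℂ => a * b * c * d * α * t⁻¹ * q⁻¹) (by fun_prop)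
  have c3 : ContinuousAt (fun t : ℂ => qPochInf (α * t) q) 1 :=
    hc.continuousAt.comp (f := fun t : ℂ => α * t) (by fun_prop)
  have n2 := c2.eventually_ne (qPochInf_ne_zero hq fun k => by simpa using hα' k :
    qPochInf (a * b * c * d * α * 1⁻¹ * q⁻¹) q ≠ 0)
  have n3 := c3.eventually_ne (qPochInf_ne_zero hq fun k => by simpa using (hα.2 k).2.2.2 :
    qPochInf (α * 1) q ≠ 0)
  have n4 : ∀ᶠ t in 𝓝 (1 : ℂ), ∀ i ∈ Finset.range n, t ^ 2 ≠ a * b * c * d * q ^ (2 * i) := by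
    refine (Filter.eventually_all_finset _).2 fun i _ => ?_
    have : ContinuousAt (fun t : ℂ => t ^ 2) 1 := by fun_prop
    refine this.eventually_ne ?_
    rw [one_pow]
    exact_mod_cast one_ne_abcd_mul_zpow hq0 habcd i
  filter_upwards [n2, n3, n4, eventually_ne_nhds one_ne_zero] with t h2 h3 h4 h5
  exact ⟨h5, fun k => ⟨fun h => h3 (qPochInf_eq_zero hq h), fun h => h2 (qPochInf_eq_zero hq h)⟩,
    fun i hi => h4 i (Finset.mem_range.2 hi)⟩

end

/-! ### The raising operator in terms of `L` and multiplication by `z + 1/z` -/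

section

variable {q a b c d z : ℂ}

theorem numF_decomp {q s r e1 e2 e3 z : ℂ} (hq : q ≠ 0) (h2 : 1 + q ≠ 0)
    (hz : z ≠ 0) (hsr : s - r ≠ 0) :
    (1 - q) * (1 + q) * (numF q s r e1 e2 e3 z z⁻¹ * (z - q * z⁻¹) * (z - z⁻¹)) =
      -q * ((q⁻¹ * z + q * z⁻¹) *
        (numA' s r e1 e2 e3 z z⁻¹ * (z - q * z⁻¹) + numA' s r e1 e2 e3 z⁻¹ z * (q * z - z⁻¹) +
        -(1 - s) * (1 - r / q) * (z - z⁻¹) * (q * z - z⁻¹) * (z - q * z⁻¹)) -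
        (numA' s r e1 e2 e3 z z⁻¹ * (z - q * z⁻¹) + numA' s r e1 e2 e3 z⁻¹ z * (q * z - z⁻¹)) *
          (z + z⁻¹) - -(1 - s * q) * (1 - r / q ^ 2) * (z + z⁻¹) *
            ((z - z⁻¹) * (q * z - z⁻¹) * (z - q * z⁻¹))) +
      (1 - q) * (1 + q) * (((s * (e3 + q * e1) - e3 * q - r * s * e1) / (s - r)) / q -
        e3 / (q * (1 + q)) - e1 / (1 + q)) *
          ((z - z⁻¹) * (q * z - z⁻¹) * (z - q * z⁻¹)) := by
  unfold numF numA'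
  field_simp
  ring

/-- On eigenfunctions, the raising operator is a combination of `L ∘ χ`, `χ` and the identity. -/
theorem exists_raiseOp_eq (hq : q ≠ 0) (h1 : 1 - q ≠ 0) (h2 : 1 + q ≠ 0) {t : ℂ} {n : ℤ}
    (ht : t ≠ 0) (hn : t ^ 2 ≠ a * b * c * d * q ^ (2 * n)) :
    ∃ κ₀ : ℂ, ∀ (z : ℂ) (f : ℂ → ℂ), RegularPoint q z →
      awOp q a b c d f z = eigval q a b c d t n * f z →
      raiseOp q a b c d t n f z =
        -q / ((1 - q) * (1 + q)) * (awOp q a b c d (fun w => (w + w⁻¹) * f w) z -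
          eigval q a b c d t (n - 1) * ((z + z⁻¹) * f z)) + κ₀ * f z := by
  obtain ⟨s, r, hs, hs0, hr, hsr, h4⟩ := exists_spectral_param hq ht hn
  set e1 := a + b + c + d
  set e3 := a * b * c + a * b * d + b * c * d + a * c * d
  -- The first term is the coefficient of `z` in `numF` divided by `q`; the other two are the
  -- constants that balance `numF_decomp`.
  refine ⟨((s * (e3 + q * e1) - e3 * q - r * s * e1) / (s - r)) / q -
        e3 / (q * (1 + q)) - e1 / (1 + q), fun z f hz hf => ?_⟩
  have hw := hz.sub_inv_ne_zero
  have hd1 := hz.mul_sub_inv_ne_zero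
  have hd2 := hz.sub_mul_inv_ne_zero
  have key := numF_decomp (e1 := e1) (e2 := coefA0 a b c d) (e3 := e3) hq h2 hz.1 hsr
  have hF : funF q a b c d t n z = -q / ((1 - q) * (1 + q)) *
      ((q⁻¹ * z + q * z⁻¹) * (vCoef q a b c d z + vCoef q a b c d z⁻¹ + eigval q a b c d t n) -
        (vCoef q a b c d z + vCoef q a b c d z⁻¹) * (z + z⁻¹) -
        eigval q a b c d t (n - 1) * (z + z⁻¹)) +
      (((s * (e3 + q * e1) - e3 * q - r * s * e1) / (s - r)) / q -
        e3 / (q * (1 + q)) - e1 / (1 + q)) := by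
    rw [funF_eq hq h1 h2 hs hs0 hr hsr, eigval_eq hq hs hs0 hr, eigval_pred hq hs hs0 hr,
      hz.vCoef_eq, hz.vCoef_inv_eq, numA_eq_numA' h4, numA_eq_numA' h4]
    generalize -(1 - s) * (1 - r / q) = l at *
    generalize -(1 - s * q) * (1 - r / q ^ 2) = l' at *
    generalize ((s * (e3 + q * e1) - e3 * q - r * s * e1) / (s - r)) / q -
        e3 / (q * (1 + q)) - e1 / (1 + q) = κ at *
    generalize numF _ _ _ _ _ _ z z⁻¹ = N2 at *
    generalize numA' _ _ _ _ _ z⁻¹ z = B1 at *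
    generalize numA' _ _ _ _ _ z z⁻¹ = B2 at *
    generalize q⁻¹ * z + q * z⁻¹ = X at *
    generalize q * z - z⁻¹ = D1 at *
    generalize z - q * z⁻¹ = D2 at *
    generalize z - z⁻¹ = w at *
    generalize z + z⁻¹ = Y at *
    generalize 1 - q = Q1 at *
    generalize 1 + q = Q2 at *
    field_simp
    linear_combination key
  unfold raiseOp
  rw [hF, hz.funA_eq]
  unfold awOp at hf ⊢
  have hz0 := hz.1
  simp only [mul_inv, inv_inv]
  -- In `L(Xf) - X(z/q) Lf` the value `f(z/q)` drops out, and `f(qz)` gets the factor `X(qz) -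
  -- X(z/q)`, a multiple of `z - z⁻¹`. This matches `𝒜(z) f(qz)`.
  have e : z - z⁻¹ = -q / ((1 - q) * (1 + q)) * ((q * z + q⁻¹ * z⁻¹) - (q⁻¹ * z + q * z⁻¹)) := by
    field_simp; ring
  linear_combination vCoef q a b c d z * f (q * z) * e +
    q / ((1 - q) * (1 + q)) * (q⁻¹ * z + q * z⁻¹) * hf

end

/-! ### Triangularity in the basis `(az, a/z; q)_k` and uniqueness of eigenfunctions -/

/-- `(az, a/z; q)_k`. -/
def phiPoch (q a : ℂ) (k : ℕ) (z : ℂ) : ℂ := qPoch (a * z) q k * qPoch (a * z⁻¹) q k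

section

variable {q a b c d z : ℂ}

theorem psi_pow (hq : ‖q‖ < 1) (hz : GenericPoint q a 1 z) (k : ℕ) :
    psi q a (q ^ k) z = phiPoch q a k z := by
  have n1 : qPochInf (a * z) q ≠ 0 :=
    qPochInf_ne_zero hq fun k => by simpa using (hz.ne_one k).1
  have n2 : qPochInf (a * z⁻¹) q ≠ 0 :=
    qPochInf_ne_zero hq fun k => by simpa using (hz.ne_one k).2.1
  have h := psi_mul_pow hq hz k
  have h1 : psi q a 1 z = 1 := by simp [psi, n1, n2]
  rwa [h1, one_mul, one_mul, mul_one] at h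

theorem eigval_one_natCast (hq0 : q ≠ 0) (k : ℕ) :
    eigval q a b c d 1 k = -(1 - (q ^ k)⁻¹) * (1 - a * b * c * d * q ^ k * q⁻¹) := by
  unfold eigval
  rw [zpow_sub_one₀ hq0, zpow_neg, zpow_natCast]
  ring

theorem awOp_phiPoch (hq0 : q ≠ 0) (hq : ‖q‖ < 1) (hz : GenericPoint q a 1 z) (k : ℕ) :
    awOp q a b c d (phiPoch q a k) z =
      eigval q a b c d 1 k * phiPoch q a k z +
        lowerCoef q a b c d (q ^ k) * psi q a (q⁻¹ * q ^ k) z := by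
  have hz' : GenericPoint q a (q ^ k) z := by
    simpa only [one_mul, zpow_natCast] using hz.mul_zpow hq0 (k : ℤ)
  rw [eigval_one_natCast hq0, ← psi_pow hq hz, ← awOp_psi hq0 hq (pow_ne_zero _ hq0) hz']
  exact awOp_congr (psi_pow hq (hz.mul_left hq0) k).symm (psi_pow hq hz k).symm
    (psi_pow hq (hz.inv_mul_left hq0) k).symm

theorem awOp_phiPoch_zero (hq0 : q ≠ 0) (hq : ‖q‖ < 1) (hz : GenericPoint q a 1 z) :
    awOp q a b c d (phiPoch q a 0) z = eigval q a b c d 1 (0 : ℕ) * phiPoch q a 0 z := by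
  rw [awOp_phiPoch hq0 hq hz]
  simp [lowerCoef]

theorem awOp_phiPoch_succ (hq0 : q ≠ 0) (hq : ‖q‖ < 1) (hz : GenericPoint q a 1 z) (k : ℕ) :
    awOp q a b c d (phiPoch q a (k + 1)) z =
      eigval q a b c d 1 (k + 1 : ℕ) * phiPoch q a (k + 1) z +
        lowerCoef q a b c d (q ^ (k + 1)) * phiPoch q a k z := by
  rw [awOp_phiPoch hq0 hq hz, ← psi_pow hq hz k, pow_succ', inv_mul_cancel_left₀ hq0]

/-- The new factor in passing from `k` to `k + 1` is `1 + (aq^k)² - aq^k (z + 1/z)`; solve for `z +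
1/z`. -/
theorem chi_mul_phiPoch (hq0 : q ≠ 0) (ha : a ≠ 0) (hz : z ≠ 0) (k : ℕ) :
    (z + z⁻¹) * phiPoch q a k z =
      ((1 + (a * q ^ k) ^ 2) / (a * q ^ k)) * phiPoch q a k z +
        -(a * q ^ k)⁻¹ * phiPoch q a (k + 1) z := by
  have hqk : q ^ k ≠ 0 := pow_ne_zero _ hq0
  unfold phiPoch
  rw [qPoch_succ, qPoch_succ]
  generalize qPoch (a * z) q k = X
  generalize qPoch (a * z⁻¹) q k = Y
  field_simp
  ring

/-- Functions that agree at the generic points with a linear combination of `phiPoch q a k`,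
`k < m`. -/
def lowSpan (q a : ℂ) (m : ℕ) : Submodule ℂ (ℂ → ℂ) where
  carrier := {f | ∃ p : ℕ → ℂ, ∀ z, GenericPoint q a 1 z →
    f z = ∑ k ∈ Finset.range m, p k * phiPoch q a k z}
  zero_mem' := ⟨0, fun z _ => by simp⟩
  add_mem' := by
    rintro f g ⟨p, hp⟩ ⟨p', hp'⟩
    refine ⟨p + p', fun z hz => ?_⟩
    simp only [Pi.add_apply, hp z hz, hp' z hz, add_mul, Finset.sum_add_distrib]
  smul_mem' := by
    rintro x f ⟨p, hp⟩
    refine ⟨x • p, fun z hz => ?_⟩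
    simp only [Pi.smul_apply, smul_eq_mul, hp z hz, Finset.mul_sum, mul_assoc]

theorem lowSpan_congr {m : ℕ} {f g : ℂ → ℂ} (hf : f ∈ lowSpan q a m)
    (h : ∀ z, GenericPoint q a 1 z → g z = f z) : g ∈ lowSpan q a m := by
  obtain ⟨p, hp⟩ := hf
  exact ⟨p, fun z hz => (h z hz).trans (hp z hz)⟩

theorem phiPoch_mem_lowSpan {k m : ℕ} (h : k < m) : phiPoch q a k ∈ lowSpan q a m :=
  ⟨fun i => if i = k then 1 else 0, fun z _ => by simp [h]⟩

theorem exists_eq_sum_of_mem_lowSpan {m : ℕ} {f : ℂ → ℂ} (hf : f ∈ lowSpan q a m) :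
    ∃ p : ℕ → ℂ, ∀ z, GenericPoint q a 1 z →
      f z = (∑ k ∈ Finset.range m, p k • phiPoch q a k) z := by
  obtain ⟨p, hp⟩ := hf
  exact ⟨p, fun z hz => by rw [hp z hz]; simp⟩

theorem lowSpan_mono {m m' : ℕ} (h : m ≤ m') : lowSpan q a m ≤ lowSpan q a m' := by
  intro f hf
  obtain ⟨p, hp⟩ := exists_eq_sum_of_mem_lowSpan hf
  exact lowSpan_congr (Submodule.sum_mem _ fun k hk => Submodule.smul_mem _ _
    (phiPoch_mem_lowSpan ((Finset.mem_range.1 hk).trans_le h))) hp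

theorem awOp_sum_smul (s : Finset ℕ) (p : ℕ → ℂ) (F : ℕ → ℂ → ℂ) :
    awOp q a b c d (∑ k ∈ s, p k • F k) z = ∑ k ∈ s, p k * awOp q a b c d (F k) z := by
  unfold awOp
  simp only [Finset.sum_apply, Pi.smul_apply, smul_eq_mul, Finset.mul_sum, mul_add, mul_sub,
    Finset.sum_add_distrib, Finset.sum_sub_distrib]
  simp only [mul_left_comm]

theorem awOp_phiPoch_sub_mem (hq0 : q ≠ 0) (hq : ‖q‖ < 1) (k : ℕ) :
    awOp q a b c d (phiPoch q a k) - eigval q a b c d 1 k • phiPoch q a k ∈ lowSpan q a k := by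
  cases k with
  | zero =>
    refine lowSpan_congr (Submodule.zero_mem _) fun z hz => ?_
    simp [awOp_phiPoch_zero hq0 hq hz]
  | succ k =>
    refine lowSpan_congr (Submodule.smul_mem _ (lowerCoef q a b c d (q ^ (k + 1)))
      (phiPoch_mem_lowSpan (Nat.lt_succ_self k))) fun z hz => ?_
    simp only [Pi.sub_apply, Pi.smul_apply, smul_eq_mul, awOp_phiPoch_succ hq0 hq hz]
    ring

theorem awOp_phiPoch_mem (hq0 : q ≠ 0) (hq : ‖q‖ < 1) {k m : ℕ} (h : k < m) :
    awOp q a b c d (phiPoch q a k) ∈ lowSpan q a m := by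
  have h1 := lowSpan_mono h.le (awOp_phiPoch_sub_mem (a := a) (b := b) (c := c) (d := d) hq0 hq k)
  have h2 := Submodule.smul_mem _ (eigval q a b c d 1 k) (phiPoch_mem_lowSpan (q := q) (a := a) h)
  simpa using Submodule.add_mem _ h1 h2

theorem awOp_mem_lowSpan (hq0 : q ≠ 0) (hq : ‖q‖ < 1) {m : ℕ} {f : ℂ → ℂ}
    (hf : f ∈ lowSpan q a m) : awOp q a b c d f ∈ lowSpan q a m := by
  obtain ⟨p, hp⟩ := exists_eq_sum_of_mem_lowSpan hf
  refine lowSpan_congr (Submodule.sum_mem (t := Finset.range m)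
    (f := fun k => p k • awOp q a b c d (phiPoch q a k)) _ fun k hk =>
    Submodule.smul_mem _ _ (awOp_phiPoch_mem hq0 hq (Finset.mem_range.1 hk))) fun z hz => ?_
  rw [awOp_congr (hp _ (hz.mul_left hq0)) (hp _ hz) (hp _ (hz.inv_mul_left hq0)), awOp_sum_smul]
  simp

theorem chi_mul_mem_lowSpan (hq0 : q ≠ 0) (ha : a ≠ 0) {m : ℕ} {f : ℂ → ℂ}
    (hf : f ∈ lowSpan q a m) : (fun w => (w + w⁻¹) * f w) ∈ lowSpan q a (m + 1) := by
  obtain ⟨p, hp⟩ := exists_eq_sum_of_mem_lowSpan hf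
  refine lowSpan_congr (Submodule.sum_mem (t := Finset.range m)
    (f := fun k => p k • (((1 + (a * q ^ k) ^ 2) / (a * q ^ k)) • phiPoch q a k +
      (-(a * q ^ k)⁻¹) • phiPoch q a (k + 1))) _ fun k hk => ?_) fun z hz => ?_
  · have hk' := Finset.mem_range.1 hk
    exact Submodule.smul_mem _ _ (Submodule.add_mem _
      (Submodule.smul_mem _ _ (phiPoch_mem_lowSpan (by omega)))
      (Submodule.smul_mem _ _ (phiPoch_mem_lowSpan (by omega))))
  · rw [hp z hz]
    simp only [Finset.sum_apply, Pi.smul_apply, Pi.add_apply, smul_eq_mul, Finset.mul_sum]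
    refine Finset.sum_congr rfl fun k _ => ?_
    rw [mul_left_comm, chi_mul_phiPoch hq0 ha hz.1]

/-- At the generic points, `f` equals `p * phiPoch q a m` up to an element of
`lowSpan q a m`. -/
def HasLead (q a : ℂ) (m : ℕ) (p : ℂ) (f : ℂ → ℂ) : Prop :=
  f - p • phiPoch q a m ∈ lowSpan q a m

theorem HasLead.congr {m : ℕ} {p : ℂ} {f g : ℂ → ℂ} (hf : HasLead q a m p f)
    (h : ∀ z, GenericPoint q a 1 z → g z = f z) : HasLead q a m p g :=
  lowSpan_congr hf fun z hz => by simp [h z hz]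

theorem HasLead.add {m : ℕ} {p p' : ℂ} {f g : ℂ → ℂ} (hf : HasLead q a m p f)
    (hg : HasLead q a m p' g) : HasLead q a m (p + p') (f + g) := by
  have := Submodule.add_mem _ hf hg
  rwa [HasLead, add_smul, add_sub_add_comm]

theorem HasLead.smul {m : ℕ} {p : ℂ} {f : ℂ → ℂ} (hf : HasLead q a m p f) (x : ℂ) :
    HasLead q a m (x * p) (x • f) := by
  have := Submodule.smul_mem _ x hf
  rwa [HasLead, mul_smul, ← smul_sub]

theorem HasLead.mem {m : ℕ} {p : ℂ} {f : ℂ → ℂ} (hf : HasLead q a m p f) :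
    f ∈ lowSpan q a (m + 1) := by
  have := Submodule.add_mem _ (lowSpan_mono (Nat.le_succ m) hf)
    (Submodule.smul_mem _ p (phiPoch_mem_lowSpan (Nat.lt_succ_self m)))
  rwa [sub_add_cancel] at this

theorem hasLead_zero_iff {m : ℕ} {f : ℂ → ℂ} : HasLead q a m 0 f ↔ f ∈ lowSpan q a m := by
  simp [HasLead]

theorem HasLead.awOp (hq0 : q ≠ 0) (hq : ‖q‖ < 1) {m : ℕ} {p : ℂ} {f : ℂ → ℂ}
    (hf : HasLead q a m p f) :
    HasLead q a m (eigval q a b c d 1 m * p) (awOp q a b c d f) := by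
  have h1 := awOp_mem_lowSpan (b := b) (c := c) (d := d) hq0 hq hf
  have h2 := Submodule.smul_mem _ p (awOp_phiPoch_sub_mem (a := a) (b := b) (c := c) (d := d)
    hq0 hq m)
  refine lowSpan_congr (Submodule.add_mem _ h1 h2) fun z hz => ?_
  unfold AskeyWilson.awOp
  simp only [Pi.add_apply, Pi.sub_apply, Pi.smul_apply, smul_eq_mul]
  ring

theorem HasLead.chi_mul (hq0 : q ≠ 0) (ha : a ≠ 0) {m : ℕ} {p : ℂ} {f : ℂ → ℂ}
    (hf : HasLead q a m p f) :
    HasLead q a (m + 1) (-(a * q ^ m)⁻¹ * p) (fun w => (w + w⁻¹) * f w) := by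
  have h1 := chi_mul_mem_lowSpan hq0 ha hf
  have h2 := Submodule.smul_mem _ (p * ((1 + (a * q ^ m) ^ 2) / (a * q ^ m)))
    (phiPoch_mem_lowSpan (q := q) (a := a) (Nat.lt_succ_self m))
  refine lowSpan_congr (Submodule.add_mem _ h1 h2) fun z hz => ?_
  simp only [Pi.add_apply, Pi.sub_apply, Pi.smul_apply, smul_eq_mul]
  linear_combination p * chi_mul_phiPoch hq0 ha hz.1 m

/-- A triangular operator has no nonzero eigenvector for an eigenvalue off its diagonal. Applying `L
- λ(m)` removes the top basis element, yet on `f` it is multiplication by the nonzero scalar `lam -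
λ(m)`, so `f` already lies in the smaller span. -/
theorem eq_zero_of_mem_lowSpan (hq0 : q ≠ 0) (hq : ‖q‖ < 1) {lam : ℂ} {f : ℂ → ℂ} {m : ℕ}
    (hf : f ∈ lowSpan q a m) (hL : ∀ z, GenericPoint q a 1 z → awOp q a b c d f z = lam * f z)
    (hlam : ∀ k < m, lam - eigval q a b c d 1 k ≠ 0) (hz : GenericPoint q a 1 z) : f z = 0 := by
  induction m with
  | zero =>
    obtain ⟨p, hp⟩ := hf
    simpa using hp z hz
  | succ m ih =>
    refine ih ?_ fun k hk => hlam k (hk.trans (Nat.lt_succ_self m))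
    obtain ⟨p, hp⟩ := exists_eq_sum_of_mem_lowSpan hf
    have hlead : HasLead q a m (p m) f := by
      refine lowSpan_congr (Submodule.sum_mem (t := Finset.range m)
        (f := fun k => p k • phiPoch q a k) _ fun k hk => Submodule.smul_mem _ _
          (phiPoch_mem_lowSpan (Finset.mem_range.1 hk))) fun z hz => ?_
      simp [hp z hz, Finset.sum_range_succ]
    have h := (hlead.awOp (b := b) (c := c) (d := d) hq0 hq).add
      (hlead.smul (-eigval q a b c d 1 m))
    rw [show eigval q a b c d 1 m * p m + -eigval q a b c d 1 m * p m = 0 by ring,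
      hasLead_zero_iff] at h
    refine lowSpan_congr (Submodule.smul_mem _ (lam - eigval q a b c d 1 m)⁻¹ h) fun w hw => ?_
    have hne := hlam m (Nat.lt_succ_self m)
    simp only [Pi.add_apply, Pi.smul_apply, smul_eq_mul, hL w hw]
    field_simp
    ring

end

/-! ### Askey-Wilson polynomials and the raising operator at `t = 1` -/

section

variable {q a b c d z : ℂ}

/-- The coefficient of `phiPoch q a k` in `awPoly q a b c d n`. -/
def awCoef (q a b c d : ℂ) (n k : ℕ) : ℂ :=
  qPoch (a * b) q n * qPoch (a * c) q n * qPoch (a * d) q n / a ^ n *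
    uCoef q a b c d 1 (q ^ (-(n : ℤ))) k

theorem awCoef_eq_zero (hq0 : q ≠ 0) {n k : ℕ} (h : n < k) : awCoef q a b c d n k = 0 := by
  rw [awCoef, uCoef, qPoch_eq_zero (j := n) _ h]
  · simp
  · rw [one_mul, zpow_neg, zpow_natCast, inv_mul_cancel₀ (pow_ne_zero _ hq0)]

theorem awPoly_eq_tsum (hq0 : q ≠ 0) (n : ℕ) :
    awPoly q a b c d n z = ∑' k : ℕ, awCoef q a b c d n k * phiPoch q a k z := by
  unfold awPoly phi43
  rw [← tsum_mul_left]
  refine tsum_congr fun k => ?_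
  have e : a * b * c * d * 1 * (q ^ (-(n : ℤ)))⁻¹ * q⁻¹ =
      a * b * c * d * q ^ ((n : ℤ) - 1) := by
    rw [zpow_sub_one₀ hq0, zpow_neg, inv_inv]; ring
  unfold awCoef uCoef uDenom phiPoch
  rw [e]
  simp only [mul_one, one_mul, div_eq_mul_inv, mul_inv]
  ring

theorem awPoly_eq_sum (hq0 : q ≠ 0) (n : ℕ) (z : ℂ) :
    awPoly q a b c d n z = ∑ k ∈ Finset.range (n + 1), awCoef q a b c d n k * phiPoch q a k z := by
  rw [awPoly_eq_tsum hq0]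
  refine tsum_eq_sum fun k hk => ?_
  rw [awCoef_eq_zero hq0 (by rw [Finset.mem_range] at hk; omega), zero_mul]

/-- `P_n` is the terminating case `t = q⁻ⁿ`, `α = 1` of `u`, so its eigenvalue equation comes from
`awOp_uFun`. -/
theorem awPoly_eq_uFun (hq0 : q ≠ 0) (hq : ‖q‖ < 1) (hz : GenericPoint q a 1 z) (n : ℕ) :
    awPoly q a b c d n z = qPoch (a * b) q n * qPoch (a * c) q n * qPoch (a * d) q n / a ^ n *
      uFun q a b c d 1 (q ^ (-(n : ℤ))) z := by
  rw [awPoly_eq_tsum hq0, uFun_eq_tsum hq hz, ← tsum_mul_left]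
  refine tsum_congr fun k => ?_
  rw [one_mul, psi_pow hq hz, awCoef, mul_assoc]

theorem eigval_one_sub (hq0 : q ≠ 0) (m k : ℤ) :
    eigval q a b c d 1 m - eigval q a b c d 1 k =
      (q ^ m)⁻¹ * (1 - q ^ (m - k)) * (1 - a * b * c * d * q ^ (m + k - 1)) := by
  have h1 := zpow_ne_zero m hq0
  have h2 := zpow_ne_zero k hq0
  unfold eigval
  rw [zpow_sub_one₀ hq0, zpow_sub_one₀ hq0, zpow_sub_one₀ hq0, zpow_sub₀ hq0, zpow_add₀ hq0,
    zpow_neg, zpow_neg]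
  field_simp
  ring

theorem abcd_mul_zpow_ne_one (hq0 : q ≠ 0) (h : ∀ k : ℕ, a * b * c * d * q⁻¹ * q ^ k ≠ 1) (k : ℕ) :
    a * b * c * d * q ^ ((k : ℤ) - 1) ≠ 1 := by
  rw [zpow_sub_one₀ hq0, zpow_natCast, mul_comm (q ^ k), ← mul_assoc]
  exact h k

/-- The range `0 ≤ m + k` covers both `λ(n+1)` against `λ(k)` with `0 ≤ k ≤ n` and `λ(n+1)` against
`λ(n-1)`, including `λ(-1)` when `n = 0`. -/
theorem eigval_one_sub_ne_zero (hq0 : q ≠ 0) (hq : ‖q‖ < 1)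
    (habcd : ∀ k : ℕ, a * b * c * d * q⁻¹ * q ^ k ≠ 1) {m k : ℤ} (hkm : k < m) (h0 : 0 ≤ m + k) :
    eigval q a b c d 1 m - eigval q a b c d 1 k ≠ 0 := by
  rw [eigval_one_sub hq0]
  obtain ⟨i, hi⟩ := Int.eq_ofNat_of_zero_le h0
  obtain ⟨j, hj⟩ := Int.eq_ofNat_of_zero_le (sub_pos.2 hkm).le
  rw [hi, hj, zpow_natCast]
  refine mul_ne_zero (mul_ne_zero (inv_ne_zero (zpow_ne_zero _ hq0))
    (sub_ne_zero.2 (pow_ne_one_of_norm_lt_one hq ?_).symm))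
    (sub_ne_zero.2 (abcd_mul_zpow_ne_one hq0 habcd i).symm)
  omega

section

variable (hq0 : q ≠ 0) (hq : ‖q‖ < 1) (ha : a ≠ 0) (hab : ∀ k : ℕ, a * b * q ^ k ≠ 1)
  (hac : ∀ k : ℕ, a * c * q ^ k ≠ 1) (had : ∀ k : ℕ, a * d * q ^ k ≠ 1)

include hq0 hq ha hab hac had

omit hq0 hq in
theorem awPoly_prefactor_ne_zero (n : ℕ) :
    qPoch (a * b) q n * qPoch (a * c) q n * qPoch (a * d) q n / a ^ n ≠ 0 :=
  div_ne_zero (mul_ne_zero (mul_ne_zero (qPoch_ne_zero hab n) (qPoch_ne_zero hac n))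
    (qPoch_ne_zero had n)) (pow_ne_zero _ ha)

omit ha in
-- At `t = q⁻ⁿ` both boundary terms disappear, the one at infinity because `(q⁻ⁿ; q)_∞ = 0`.
theorem awOp_awPoly (n : ℕ) (hz : GenericPoint q a 1 z) :
    awOp q a b c d (awPoly q a b c d n) z =
      eigval q a b c d 1 n * awPoly q a b c d n z := by
  have hd := nonvanishingDenom_one hq hab hac had
  have ht : q ^ (-(n : ℤ)) ≠ 0 := zpow_ne_zero _ hq0
  have hu := awOp_uFun hq0 hq hd one_ne_zero ht hz
  rw [show lowerCoef q a b c d 1 = 0 by simp [lowerCoef], qPochInf_eq_zero hq (j := n) (by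
    rw [one_mul, zpow_neg, zpow_natCast, inv_mul_cancel₀ (pow_ne_zero _ hq0)])] at hu
  have e : eigval q a b c d (q ^ (-(n : ℤ))) 0 = eigval q a b c d 1 n := by
    rw [eigval_eq (s := q ^ (-(n : ℤ))) hq0 (by simp) ht rfl,
      eigval_eq (s := q ^ (-(n : ℤ))) hq0 (by simp) ht rfl]
  rw [awOp_congr (g := fun w => qPoch (a * b) q n * qPoch (a * c) q n * qPoch (a * d) q n / a ^ n *
    uFun q a b c d 1 (q ^ (-(n : ℤ))) w) (awPoly_eq_uFun hq0 hq (hz.mul_left hq0) n) (awPoly_eq_uFun hq0 hq hz n)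
    (awPoly_eq_uFun hq0 hq (hz.inv_mul_left hq0) n), awOp_const_mul, hu, e,
    awPoly_eq_uFun hq0 hq hz]
  ring

omit hq ha hab hac had in
theorem hasLead_awPoly (n : ℕ) :
    HasLead q a n (awCoef q a b c d n n) (awPoly q a b c d n) := by
  refine lowSpan_congr (Submodule.sum_mem (t := Finset.range n)
    (f := fun k => awCoef q a b c d n k • phiPoch q a k) _ fun k hk => Submodule.smul_mem _ _
      (phiPoch_mem_lowSpan (Finset.mem_range.1 hk))) fun z hz => ?_
  simp [awPoly_eq_sum hq0, Finset.sum_range_succ]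

theorem awCoef_self_ne_zero (habcd : ∀ k : ℕ, a * b * c * d * q⁻¹ * q ^ k ≠ 1) (n : ℕ) :
    awCoef q a b c d n n ≠ 0 := by
  have hd := nonvanishingDenom_one hq hab hac had
  refine mul_ne_zero (awPoly_prefactor_ne_zero ha hab hac had n) (mul_ne_zero
    (div_ne_zero (mul_ne_zero ?_ ?_) (hd.uDenom_ne_zero n)) (pow_ne_zero _ hq0))
  · refine Finset.prod_ne_zero_iff.2 fun i hi => sub_ne_zero.2 fun h => ?_
    have hi' := Finset.mem_range.1 hi
    refine pow_ne_one_of_norm_lt_one hq (Nat.sub_ne_zero_of_lt hi') ?_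
    have h1 := pow_sub₀ q hq0 hi'.le
    rw [one_mul, zpow_neg, zpow_natCast] at h
    rw [h1, ← inv_inj, mul_inv, inv_inv, inv_one, h]
  · refine qPoch_ne_zero (fun k h => habcd (n + k) ?_) n
    rw [← h, zpow_neg, inv_inv, zpow_natCast, pow_add]
    ring

/-- At `t = 1`, the raising operator maps the Askey-Wilson polynomial of degree `n` to a nonzero
multiple of the one of degree `n + 1`. -/
theorem exists_raiseOp_awPoly (habcd : ∀ k : ℕ, a * b * c * d * q⁻¹ * q ^ k ≠ 1) (n : ℕ) :
    ∃ C : ℂ, C ≠ 0 ∧ ∀ z, GenericPoint q a 1 z →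
      raiseOp q a b c d 1 n (awPoly q a b c d n) z = C * awPoly q a b c d (n + 1) z := by
  have h1 := one_sub_ne_zero_of_norm_lt_one hq
  have h2 := one_add_ne_zero_of_norm_lt_one hq
  have hn : (1 : ℂ) ^ 2 ≠ a * b * c * d * q ^ (2 * (n : ℤ)) := by
    rw [one_pow]; exact one_ne_abcd_mul_zpow hq0 habcd n
  have hL := fun (k : ℕ) (w : ℂ) (hw : GenericPoint q a 1 w) =>
    awOp_awPoly hq0 hq hab hac had k hw
  obtain ⟨κ, hκ⟩ := exists_raiseOp_eq hq0 h1 h2 one_ne_zero hn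
  have hP := hasLead_awPoly (a := a) (b := b) (c := c) (d := d) hq0 n
  have hχ := hP.chi_mul hq0 ha
  have hlead := (((hχ.awOp (b := b) (c := c) (d := d) hq0 hq).add
    (hχ.smul (-eigval q a b c d 1 (n - 1)))).smul (-q / ((1 - q) * (1 + q)))).add
      ((hasLead_zero_iff.2 hP.mem).smul κ)
  have hne := awCoef_self_ne_zero hq0 hq ha hab hac had habcd (n + 1)
  set p := awCoef q a b c d n n with hp
  set p' := awCoef q a b c d (n + 1) (n + 1) with hp'
  -- The leading coefficient of the image: multiplication by `z + 1/z` contributes `-(a q^n)⁻¹`, and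
  -- `L - λ(n-1)` contributes the eigenvalue gap. The `κ` term has lower degree.
  set l := -q / ((1 - q) * (1 + q)) * ((eigval q a b c d 1 (n + 1 : ℕ) -
    eigval q a b c d 1 (n - 1)) * (-(a * q ^ n)⁻¹ * p)) with hl
  have hl0 : l ≠ 0 := by
    refine mul_ne_zero (div_ne_zero (neg_ne_zero.2 hq0) (mul_ne_zero h1 h2)) (mul_ne_zero
      (eigval_one_sub_ne_zero hq0 hq habcd (by push_cast; omega) (by push_cast; omega))
      (mul_ne_zero (neg_ne_zero.2 (inv_ne_zero (mul_ne_zero ha (pow_ne_zero _ hq0))))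
        (awCoef_self_ne_zero hq0 hq ha hab hac had habcd n)))
  have hR : HasLead q a (n + 1) l (raiseOp q a b c d 1 n (awPoly q a b c d n)) := by
    have := hlead.congr (g := raiseOp q a b c d 1 n (awPoly q a b c d n)) fun z hz => by
      rw [hκ z _ hz.regular (hL n z hz)]
      simp only [Pi.add_apply, Pi.smul_apply, smul_eq_mul]
      ring
    convert this using 1
    rw [hl]; ring
  refine ⟨l / p', div_ne_zero hl0 hne, fun z hz => ?_⟩
  -- Subtracting the multiple of `P_{n+1}` with the same leading coefficient leaves an eigenfunction
  -- for `λ(n+1)` of degree at most `n`, which must vanish.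
  have hD := hR.add ((hasLead_awPoly (a := a) (b := b) (c := c) (d := d) hq0 (n + 1)).smul (-(l / p')))
  rw [← hp', show l + -(l / p') * p' = 0 by field_simp; ring, hasLead_zero_iff] at hD
  have h0 := eq_zero_of_mem_lowSpan (b := b) (c := c) (d := d)
    (lam := eigval q a b c d 1 (n + 1)) hq0 hq hD (fun w hw => ?_) (fun k hk =>
      eigval_one_sub_ne_zero hq0 hq habcd (by omega) (by omega)) hz
  · simp only [Pi.add_apply, Pi.smul_apply, smul_eq_mul] at h0
    linear_combination h0
  · have hr := awOp_raiseOp hq0 h1 h2 one_ne_zero hn hw.regular (hL n w hw)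
      (hL n _ (hw.mul_left hq0))
    have hr' := hL (n + 1) w hw
    push_cast at hr'
    have e : (raiseOp q a b c d 1 n (awPoly q a b c d n) +
        -(l / p') • awPoly q a b c d (n + 1)) = fun w =>
        raiseOp q a b c d 1 n (awPoly q a b c d n) w + -(l / p') * awPoly q a b c d (n + 1) w := by
      funext w; simp
    rw [e, awOp_add, awOp_const_mul, hr, hr']
    ring

/-- `limPhi` does not involve `α`, so these constants serve all admissible `α` at once. -/
theorem exists_limPhi_eq (habcd : ∀ k : ℕ, a * b * c * d * q⁻¹ * q ^ k ≠ 1) (n : ℕ) :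
    ∃ C : ℂ, C ≠ 0 ∧ ∀ z, GenericPoint q a 1 z →
      limPhi q a b c d n z = C * awPoly q a b c d n z := by
  induction n with
  | zero =>
    refine ⟨1, one_ne_zero, fun z _ => ?_⟩
    simp [limPhi, awPoly_eq_sum hq0, awCoef, uCoef, uDenom, phiPoch, qPoch_zero]
  | succ n ih =>
    obtain ⟨C, hC, h⟩ := ih
    obtain ⟨C', hC', h'⟩ := exists_raiseOp_awPoly hq0 hq ha hab hac had habcd n
    refine ⟨C * C', mul_ne_zero hC hC', fun z hz => ?_⟩
    rw [mul_assoc, ← h' z hz, limPhi, raiseOp, h _ (hz.mul_left hq0), h z hz, raiseOp]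
    ring

omit hq hab hac had in
-- The excluded points form a countable set: for each `k`, two square roots of `q^k` and four
-- explicit quotients, together with `0`.
theorem dense_genericPoint {α : ℂ} (hα : α ≠ 0) : Dense {z | GenericPoint q a α z} := by
  choose r hr using fun k : ℤ => IsAlgClosed.exists_pow_nat_eq (q ^ k) (n := 2) (by norm_num)
  have hc : ({0} ∪ ⋃ k : ℤ, {r k, -r k, q ^ k / a, a / q ^ k, q ^ k / (a * α),
      (a * α) / q ^ k} : Set ℂ).Countable :=
    (Set.countable_singleton 0).union
      (Set.countable_iUnion fun k => (Set.toFinite _).countable)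
  refine (hc.dense_compl ℂ).mono fun z hz => ?_
  simp only [Set.mem_compl_iff, Set.mem_union, Set.mem_singleton_iff, Set.mem_iUnion,
    Set.mem_insert_iff, not_or, not_exists] at hz
  obtain ⟨hz0, hz⟩ := hz
  have haα := mul_ne_zero ha hα
  refine ⟨hz0, fun k => ?_⟩
  have hqk := zpow_ne_zero k hq0
  obtain ⟨z1, z2, z3, z4, z5, z6⟩ := hz k
  refine ⟨fun h => ?_, fun h => z3 ?_, fun h => z4 ?_, fun h => z5 ?_, fun h => z6 ?_⟩
  · rw [← hr k] at h
    rcases sq_eq_sq_iff_eq_or_eq_neg.1 h with h | h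
    exacts [z1 h, z2 h]
  all_goals rw [← h]; field_simp

omit hq in
-- At `z = 1/a` only the term `k = 0` survives, since `(1; q)_k = 0` for `k ≥ 1`, and it equals the
-- nonzero prefactor. This point is not generic, so continuity and density supply a nearby one that
-- is.
theorem exists_awPoly_ne_zero {α : ℂ} (hα : α ≠ 0) (n : ℕ) :
    ∃ z, GenericPoint q a α z ∧ awPoly q a b c d n z ≠ 0 := by
  have hc : ContinuousAt (awPoly q a b c d n) a⁻¹ := by
    have e : awPoly q a b c d n = fun z =>
        ∑ k ∈ Finset.range (n + 1), awCoef q a b c d n k * phiPoch q a k z :=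
      funext (awPoly_eq_sum hq0 n)
    have ci : ContinuousAt (fun t : ℂ => t⁻¹) a⁻¹ := continuousAt_inv₀ (inv_ne_zero ha)
    rw [e]
    unfold phiPoch qPoch
    fun_prop
  have h0 : awPoly q a b c d n a⁻¹ ≠ 0 := by
    rw [awPoly_eq_sum hq0, Finset.sum_eq_single 0]
    · simpa [awCoef, uCoef, uDenom, phiPoch, qPoch_zero, -div_eq_zero_iff] using
        awPoly_prefactor_ne_zero ha hab hac had n
    · intro k _ hk
      rw [phiPoch, qPoch_eq_zero (j := 0) (by simp [ha]) (Nat.pos_of_ne_zero hk)]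
      simp
    · simp
  obtain ⟨z, hz, hz'⟩ := (dense_genericPoint hq0 ha hα).inter_nhds_nonempty
    (hc.eventually_ne h0)
  exact ⟨z, hz, hz'⟩

end

end

end AskeyWilson

end

theorem proposition3 (q a b c d : ℂ) (hq0 : q ≠ 0) (hq1 : ‖q‖ < 1) (ha : a ≠ 0)
    (hab : ∀ k : ℕ, a * b * q ^ k ≠ 1) (hac : ∀ k : ℕ, a * c * q ^ k ≠ 1)
    (had : ∀ k : ℕ, a * d * q ^ k ≠ 1) :
    (∀ α : ℂ, AskeyWilson.AdmissibleAlpha q a b c d α →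
      ∀ (n : ℕ) (t : ℂ), AskeyWilson.AdmissibleT q a b c d α n t →
        ∀ z : ℂ, AskeyWilson.GenericPoint q a α z →
          AskeyWilson.awOp q a b c d (AskeyWilson.Phi q a b c d α t n) z =
            AskeyWilson.eigval q a b c d t n * AskeyWilson.Phi q a b c d α t n z) ∧
    ((∀ k : ℕ, a * b * c * d * q⁻¹ * q ^ k ≠ 1) →
      ∃ C : ℕ → ℂ, (∀ n, C n ≠ 0) ∧
        ∀ α : ℂ, AskeyWilson.AdmissibleAlpha q a b c d α →
          (∀ k : ℕ, a * b * c * d * α * q⁻¹ * q ^ k ≠ 1) →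
          ∀ n : ℕ,
            (∀ z : ℂ, AskeyWilson.GenericPoint q a α z →
              Tendsto (fun t : ℂ => AskeyWilson.Phi q a b c d α t n z) (𝓝 1)
                (𝓝 (C n * AskeyWilson.awPoly q a b c d n z))) ∧
            ∀ᶠ t : ℂ in 𝓝 1, AskeyWilson.AdmissibleT q a b c d α n t ∧
              ∃ z : ℂ, AskeyWilson.GenericPoint q a α z ∧
                AskeyWilson.Phi q a b c d α t n z ≠ 0) := by
  refine ⟨fun α hα n t ht z hz => AskeyWilson.awOp_Phi hq0 hq1 hab hac had hα n ht hz,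
    fun habcd => ?_⟩
  choose C hC h using AskeyWilson.exists_limPhi_eq hq0 hq1 ha hab hac had habcd
  refine ⟨C, hC, fun α hα hα' n => ?_⟩
  have hlim : ∀ z : ℂ, AskeyWilson.GenericPoint q a α z →
      Tendsto (fun t : ℂ => AskeyWilson.Phi q a b c d α t n z) (𝓝 1)
        (𝓝 (C n * AskeyWilson.awPoly q a b c d n z)) := fun z hz => by
    rw [← h n z hz.one]
    exact AskeyWilson.tendsto_Phi hq0 hq1 hab hac had habcd hα hα' n hz
  -- A single generic point with nonzero limit suffices: `Φ_n(z, t)` stays nonzero there for `t`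
  -- near `1`.
  obtain ⟨z, hz, hne⟩ := AskeyWilson.exists_awPoly_ne_zero hq0 ha hab hac had
    (hα.ne_zero hq0) n
  refine ⟨hlim, ?_⟩
  filter_upwards [AskeyWilson.eventually_admissibleT hq0 hq1 habcd hα hα' n,
    (hlim z hz).eventually_ne (mul_ne_zero (hC n) hne)] with t h1 h2
  exact ⟨h1, z, hz, h2⟩
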